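/- Let $1<p<\infty$. Given $C_D$, $C_X$, $\lambda$, $C_\Omega$, there is a constant $C\ge 1$, depending only on $p$ and these four numbers, such that the following holds. Let $X$ be a complete metric space with a Borel measure $\mu$ that is doubling with constant $C_D$, and suppose that $(X,d,\mu)$ supports a $p$-Poincaré inequality with constant $C_X$ and dilation factor $\lambda$. Let $\Omega\subset X$ be a bounded domain (non-empty, open, connected) of finite perimeter, with $\mu(X\setminus\Omega)>0$. Denote by $P_\Omega$ its perimeter measure, defined on open sets by relaxation of $v\mapsto\int g_v\,d\mu$ from $N^{1,1}$ and on Borel sets by $P_\Omega(A)=\inf\{P_\Omega(U): U\supset A \text{ open}\}$. Suppose that for some $A\ge 1$ and all $z\in\Omega$, $y\in\partial\Omega$ and $0<\rho\le\operatorname{diam}\Omega$, $$\mu(B(z,\rho)\cap\Omega)\ge A^{-1}\mu(B(z,\rho)),\qquad A^{-1}\frac{\mu(B(y,\rho))}{\rho}\le P_\Omega(B(y,\rho))\le A\,\frac{\mu(B(y,\rho))}{\rho},$$ and that $(\Omega,d|_\Omega,\mu|_\Omega)$ supports a $p$-Poincaré inequality with constant $C_\Omega$ and dilation factor $1$. For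 $v\in N^{1,p}(\Omega)$ (the Newtonian space of functions in $L^p(\Omega)$ with an upper gradient in $L^p(\Omega)$) let $g_v$ be the minimal $p$-weak upper gradient of $v$ in $\Omega$, and let $Tv$ be its trace on $\partial\Omega$, given at $P_\Omega$-almost every $y\in\partial\Omega$ by $$\lim_{\rho\to0^+}\frac{1}{\mu(B(y,\rho)\cap\Omega)}\int_{B(y,\rho)\cap\Omega}|v-Tv(y)|\,d\mu=0 .$$ Let $f\in L^\infty(\partial\Omega,P_\Omega)$ and let $u\in N^{1,p}(\Omega)$ be a minimizer over $N^{1,p}(\Omega)$ of $$I(v)=\int_\Omega g_v^p\,d\mu+\int_{\partial\Omega}Tv\,f\,dP_\Omega .$$ Then for all $x\in\partial\Omega$, $0<r<R\le R_0<\operatorname{diam}(\Omega)/10$ and $k\in\mathbb{R}$, $$\int_{\Omega\cap B(x,r)}g_{(u-k)_+}^p\,d\mu\le\frac{C}{(R-r)^p}\int_{\Omega\cap B(x,R)}(u-k)_+^p\,d\mu+C\int_{\partial\Omega\cap B(x,R)}|f|\,(Tu-k)_+\,dP_\Omega .$$ -/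

import Mathlib

open MeasureTheory Filter Set Metric Topology
open scoped ENNReal NNReal

noncomputable section

/-- A (compact) rectifiable curve in `X`, parametrized by arc length on `[0, len]`.
Every rectifiable curve has such a parametrization, unique on `[0, len]`; line integrals are by
definition computed in it. -/
structure RectCurve (X : Type*) [MetricSpace X] where
  len : ℝ
  toFun : ℝ → X
  len_nonneg : 0 ≤ len
  unitSpeed : HasUnitSpeedOn toFun (Icc 0 len)

/-- The curve runs inside `U`. -/
def RectCurve.InSet {X : Type*} [MetricSpace X] (γ : RectCurve X) (U : Set X) : Prop :=
  ∀ t ∈ Icc (0 : ℝ) γ.len, γ.toFun t ∈ U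

/-- The line integral `∫_γ g ds`. -/
def RectCurve.lineIntegral {X : Type*} [MetricSpace X] (γ : RectCurve X) (g : X → ℝ≥0∞) :
    ℝ≥0∞ :=
  ∫⁻ t in Icc (0 : ℝ) γ.len, g (γ.toFun t)

/-- The upper gradient inequality `|u(y) - u(x)| ≤ ∫_γ g ds` along one curve `γ`
with end points `x`, `y`. -/
def UpperGradientIneq {X : Type*} [MetricSpace X] (u : X → ℝ) (g : X → ℝ≥0∞)
    (γ : RectCurve X) : Prop :=
  ENNReal.ofReal |u (γ.toFun γ.len) - u (γ.toFun 0)| ≤ γ.lineIntegral g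

/-- `g` is an upper gradient of `u` in `U`, where `U` is regarded as a metric space
of its own (only the values on `U`, and only the curves in `U`, matter). -/
def IsUpperGradientOn {X : Type*} [MetricSpace X] [MeasurableSpace X]
    (U : Set X) (u : X → ℝ) (g : X → ℝ≥0∞) : Prop :=
  Measurable g ∧ ∀ γ : RectCurve X, γ.InSet U → UpperGradientIneq u g γ

/-- The `p`-modulus, in the metric measure space `U`, of a family of curves. -/
def curveModulus {X : Type*} [MetricSpace X] [MeasurableSpace X] (μ : Measure X) (p : ℝ)
    (U : Set X) (Γ : Set (RectCurve X)) : ℝ≥0∞ :=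
  ⨅ (ρ : X → ℝ≥0∞) (_ : Measurable ρ) (_ : ∀ γ ∈ Γ, 1 ≤ γ.lineIntegral ρ),
    ∫⁻ x in U, ρ x ^ p ∂μ

/-- `g` is a `p`-weak upper gradient of `u` in `U`: the upper gradient inequality holds along
`p`-almost every curve in `U`. -/
def IsWeakUpperGradientOn {X : Type*} [MetricSpace X] [MeasurableSpace X] (μ : Measure X)
    (p : ℝ) (U : Set X) (u : X → ℝ) (g : X → ℝ≥0∞) : Prop :=
  Measurable g ∧
    curveModulus μ p U {γ : RectCurve X | γ.InSet U ∧ ¬ UpperGradientIneq u g γ} = 0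

/-- `g` is a minimal `p`-weak upper gradient of `u` in `U`: it is in `L^p(U)` and is below every
`p`-weak upper gradient in `L^p(U)`, almost everywhere in `U`. -/
def IsMinimalWeakUpperGradientOn {X : Type*} [MetricSpace X] [MeasurableSpace X]
    (μ : Measure X) (p : ℝ) (U : Set X) (u : X → ℝ) (g : X → ℝ≥0∞) : Prop :=
  IsWeakUpperGradientOn μ p U u g ∧ ∫⁻ x in U, g x ^ p ∂μ < ∞ ∧
    ∀ h : X → ℝ≥0∞, IsWeakUpperGradientOn μ p U u h → ∫⁻ x in U, h x ^ p ∂μ < ∞ →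
      ∀ᵐ x ∂(μ.restrict U), g x ≤ h x

open Classical in
/-- The minimal `p`-weak upper gradient `g_u` of `u` in `U`, which is unique up to null sets
(and `∞` for functions that have none). -/
def minWeakUpperGradient {X : Type*} [MetricSpace X] [MeasurableSpace X] (μ : Measure X)
    (p : ℝ) (U : Set X) (u : X → ℝ) : X → ℝ≥0∞ :=
  if h : ∃ g : X → ℝ≥0∞, IsMinimalWeakUpperGradientOn μ p U u g then h.choose else fun _ => ∞

/-- The Newtonian space `N^{1,p}(U)`: `u` is in `L^p(U)` and has an upper gradient in `L^p(U)`.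
Functions are defined pointwise. -/
def MemNewtonian {X : Type*} [MetricSpace X] [MeasurableSpace X] (μ : Measure X) (p : ℝ)
    (U : Set X) (u : X → ℝ) : Prop :=
  MemLp u (ENNReal.ofReal p) (μ.restrict U) ∧
    ∃ g : X → ℝ≥0∞, IsUpperGradientOn U u g ∧ ∫⁻ x in U, g x ^ p ∂μ < ∞

/-- `μ` is doubling with constant `CD`. -/
def IsDoublingWith {X : Type*} [MetricSpace X] [MeasurableSpace X] (μ : Measure X)
    (CD : ℝ≥0) : Prop :=
  ∀ (x : X) (r : ℝ), 0 < r → 0 < μ (ball x (2 * r)) ∧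
    μ (ball x (2 * r)) ≤ CD * μ (ball x r) ∧ μ (ball x r) < ∞

/-- The metric measure space `(U, d, μ)` supports a `p`-Poincaré inequality with constant `C`
and dilation factor `lam`. The balls of `U` are the sets `B(z,r) ∩ U` with `z ∈ U`. -/
def SupportsPoincareOn {X : Type*} [MetricSpace X] [MeasurableSpace X] (μ : Measure X) (p : ℝ)
    (U : Set X) (C : ℝ≥0) (lam : ℝ) : Prop :=
  0 < lam ∧ ∀ z ∈ U, ∀ r : ℝ, 0 < r → ∀ (u : X → ℝ) (g : X → ℝ≥0∞),
    (∀ s ⊆ U, Bornology.IsBounded s → IntegrableOn u s μ) → IsUpperGradientOn U u g →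
    ⨍⁻ y in ball z r ∩ U, ENNReal.ofReal |u y - ⨍ w in ball z r ∩ U, u w ∂μ| ∂μ ≤
      C * ENNReal.ofReal r * (⨍⁻ y in ball z (lam * r) ∩ U, g y ^ p ∂μ) ^ (1 / p)

/-- The perimeter `P_E(U)` of `E` in an open set `U`, by relaxation from `N^{1,1}(U)`. -/
def perimeterIn {X : Type*} [MetricSpace X] [MeasurableSpace X] (μ : Measure X)
    (E U : Set X) : ℝ≥0∞ :=
  ⨅ (u : ℕ → X → ℝ) (_ : ∀ k, MemNewtonian μ 1 U (u k))
    (_ : Tendsto (fun k => ∫⁻ x in U, ENNReal.ofReal |u k x - E.indicator 1 x| ∂μ)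
      atTop (𝓝 0)),
    liminf (fun k => ∫⁻ x in U, minWeakUpperGradient μ 1 U (u k) x ∂μ) atTop

open Classical in
/-- The perimeter measure `P_E`: the Borel measure `A ↦ inf {P_E(U) : U open, A ⊆ U}`.
That this set function is a measure on the Borel sets is a theorem for sets of finite perimeter;
where it failed, the value here would be the zero measure. -/
def perimeterMeasure {X : Type*} [MetricSpace X] [MeasurableSpace X] (μ : Measure X)
    (E : Set X) : Measure X :=
  if h : ∃ ν : Measure X, ∀ A : Set X, MeasurableSet A →
      ν A = ⨅ (U : Set X) (_ : IsOpen U) (_ : A ⊆ U), perimeterIn μ E U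
  then h.choose else 0

/-- `c` is the trace value at `x` of the function `u` on `Ω`. -/
def HasTraceAt {X : Type*} [MetricSpace X] [MeasurableSpace X] (μ : Measure X) (Ω : Set X)
    (u : X → ℝ) (x : X) (c : ℝ) : Prop :=
  Tendsto (fun r : ℝ => ⨍ y in ball x r ∩ Ω, |u y - c| ∂μ) (𝓝[>] 0) (𝓝 0)

open Classical in
/-- The trace `Tu` (with value `0` at the points where there is no trace value). -/
def traceFn {X : Type*} [MetricSpace X] [MeasurableSpace X] (μ : Measure X) (Ω : Set X)
    (u : X → ℝ) (x : X) : ℝ :=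
  if h : ∃ c : ℝ, HasTraceAt μ Ω u x c then h.choose else 0

/-- The standing assumptions on the domain `Ω`; `CP` is the constant in its `p`-Poincaré
inequality, which has dilation factor `1`. -/
structure IsNeumannDomain {X : Type*} [MetricSpace X] [MeasurableSpace X] (μ : Measure X)
    (p : ℝ) (CP : ℝ≥0) (Ω : Set X) : Prop where
  isOpen : IsOpen Ω
  isConnected : IsConnected Ω
  isBounded : Bornology.IsBounded Ω
  compl_pos : 0 < μ Ωᶜ
  finite_perimeter : perimeterIn μ Ω univ < ∞
  regularity : ∃ A : ℝ≥0, 1 ≤ A ∧ ∀ r : ℝ, 0 < r → r ≤ diam Ω →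
    (∀ z ∈ Ω, μ (ball z r) ≤ A * μ (ball z r ∩ Ω)) ∧
    ∀ x ∈ frontier Ω,
      μ (ball x r) / ENNReal.ofReal r ≤ A * perimeterMeasure μ Ω (ball x r) ∧
      perimeterMeasure μ Ω (ball x r) ≤ A * (μ (ball x r) / ENNReal.ofReal r)
  poincare : SupportsPoincareOn μ p Ω CP 1

/-- The functional `I(u) = ∫_Ω g_u^p dμ + ∫_{∂Ω} Tu f dP_Ω`, for `u` in `N^{1,p}(Ω)`. -/
def neumannFunctional {X : Type*} [MetricSpace X] [MeasurableSpace X] (μ : Measure X)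
    (p : ℝ) (Ω : Set X) (f u : X → ℝ) : ℝ :=
  (∫⁻ y in Ω, minWeakUpperGradient μ p Ω u y ^ p ∂μ).toReal +
    ∫ y in frontier Ω, traceFn μ Ω u y * f y ∂(perimeterMeasure μ Ω)

/-- `u` minimizes `I` in `N^{1,p}(Ω)`. -/
def IsNeumannMinimizer {X : Type*} [MetricSpace X] [MeasurableSpace X] (μ : Measure X)
    (p : ℝ) (Ω : Set X) (f u : X → ℝ) : Prop :=
  MemNewtonian μ p Ω u ∧ ∀ v : X → ℝ, MemNewtonian μ p Ω v →
    neumannFunctional μ p Ω f u ≤ neumannFunctional μ p Ω f v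

end

section

/-! ### Calculus along curves -/

/-! The competitor is v = u - ψ^p (u-k)_+, with ψ a cutoff that is 1 on B(x,r), 0 off B(x,R) and
Lipschitz with constant 1/(R-r). Where u > k, the product rule bounds the derivative of v along
curves by (1-ψ^p) g_u + p ψ^(p-1) (u-k)/(R-r); elsewhere g_u is a bound. Where ψ > 0, the first
bound is the mean of g_u and p(u-k)/((R-r)ψ) with weights 1-ψ^p and ψ^p, so convexity of t^p gives
g_v^p ≤ (1-ψ^p) g_u^p + (p/(R-r))^p (u-k)^p: the powers of ψ cancel (`rpow_cutoff_convexity`).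
Minimality bounds ∫ g_u^p by ∫ g_v^p plus the boundary term. Subtracting the finite (1-ψ^p) part
leaves the claim with constant p^p, without any iteration over radii
(`cutoff_memNewtonian_and_caccioppoli`).

Two foundations are needed. Minimal weak upper gradients must exist and lie below the explicit
bounds above. For this the inequality between end points is replaced by a bound on the derivative
along almost every curve (`DominatesDerivOn`), which is local and survives countable infima.

The boundary term needs Tv = Tu - ψ^p (Tu-k)_+ almost everywhere for the perimeter measure, hence
existence of traces (`MemNewtonian.ae_exists_hasTraceAt`). The perimeter measure has codimension at
most one, so a Vitali covering and Borel-Cantelli show that at almost every boundary point the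
averages of g^p at scale 2^(-i) are eventually O(T^(pi)) for some T < 2; the Poincaré inequality
then makes the oscillations of u decay like (T/2)^i. -/

theorem AbsolutelyContinuousOnInterval.of_dist_le {Y Z : Type*} [PseudoMetricSpace Y]
    [PseudoMetricSpace Z] {f : ℝ → Y} {g : ℝ → Z} {a b : ℝ} (K : ℝ)
    (hg : AbsolutelyContinuousOnInterval g a b)
    (h : ∀ s ∈ uIcc a b, ∀ t ∈ uIcc a b, dist (f s) (f t) ≤ K * dist (g s) (g t)) :
    AbsolutelyContinuousOnInterval f a b := by
  have hg' := Tendsto.const_mul K hg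
  rw [mul_zero] at hg'
  refine squeeze_zero' (Eventually.of_forall fun E => Finset.sum_nonneg fun i _ => dist_nonneg)
    ?_ hg'
  refine eventually_inf_principal.2 (Eventually.of_forall fun E hE => ?_)
  rw [Finset.mul_sum]
  exact Finset.sum_le_sum fun i hi => h _ (hE.1 i hi).1 _ (hE.1 i hi).2

theorem abs_le_abs_of_hasDerivAt_of_eventually_le {h k : ℝ → ℝ} {a b t : ℝ}
    (hh : HasDerivAt h a t) (hk : HasDerivAt k b t)
    (hle : ∀ᶠ s in 𝓝 t, |h s - h t| ≤ |k s - k t|) : |a| ≤ |b| := by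
  refine le_of_tendsto_of_tendsto (hasDerivAt_iff_tendsto_slope.1 hh).abs
    (hasDerivAt_iff_tendsto_slope.1 hk).abs ?_
  filter_upwards [nhdsWithin_le_nhds hle] with s hs
  rw [slope_def_field, slope_def_field, abs_div, abs_div]
  gcongr

/-- The increments of h are bounded by those of the primitive of G, which is absolutely continuous
with derivative G almost everywhere; both properties pass to h by comparison. -/
theorem absolutelyContinuous_of_le_lintegral {h : ℝ → ℝ} {G : ℝ → ℝ≥0∞} {L : ℝ} (hL : 0 ≤ L)
    (hG : AEMeasurable G (volume.restrict (Icc 0 L))) (hfin : ∫⁻ t in Icc 0 L, G t < ∞)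
    (hle : ∀ a b, 0 ≤ a → a ≤ b → b ≤ L →
      ENNReal.ofReal |h b - h a| ≤ ∫⁻ t in Icc a b, G t) :
    AbsolutelyContinuousOnInterval h 0 L ∧
      ∀ᵐ t, t ∈ Ioo 0 L → ENNReal.ofReal |deriv h t| ≤ G t := by
  have hint : IntegrableOn (fun t => (G t).toReal) (Icc 0 L) :=
    integrable_toReal_of_lintegral_ne_top hG hfin.ne
  have hII : IntervalIntegrable (fun t => (G t).toReal) volume 0 L :=
    (intervalIntegrable_iff_integrableOn_Icc_of_le hL).2 hint
  have hsub : ∀ a b, 0 ≤ a → a ≤ b → b ≤ L → |h b - h a| ≤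
      |(∫ t in (0:ℝ)..b, (G t).toReal) - ∫ t in (0:ℝ)..a, (G t).toReal| := by
    intro a b ha hab hb
    have hss : Icc a b ⊆ Icc 0 L := Icc_subset_Icc ha hb
    have h1 : ∀ c ∈ Icc 0 L, IntervalIntegrable (fun t => (G t).toReal) volume 0 c := fun c hc =>
      (intervalIntegrable_iff_integrableOn_Icc_of_le hc.1).2
        (hint.mono_set (Icc_subset_Icc le_rfl hc.2))
    rw [intervalIntegral.integral_interval_sub_left (h1 b ⟨ha.trans hab, hb⟩)
      (h1 a ⟨ha, hab.trans hb⟩)]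
    refine le_trans ?_ (le_abs_self _)
    have hfin' : ∫⁻ t in Icc a b, G t < ∞ := (lintegral_mono_set hss).trans_lt hfin
    have hG' : AEMeasurable G (volume.restrict (Icc a b)) := hG.mono_measure
      (Measure.restrict_mono hss le_rfl)
    rw [intervalIntegral.integral_of_le hab, ← integral_Icc_eq_integral_Ioc,
      integral_toReal hG' (ae_lt_top' hG' hfin'.ne)]
    exact (ENNReal.ofReal_le_iff_le_toReal hfin'.ne).1 (hle a b ha hab hb)
  have hsym : ∀ a ∈ Icc 0 L, ∀ b ∈ Icc 0 L, |h b - h a| ≤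
      |(∫ t in (0:ℝ)..b, (G t).toReal) - ∫ t in (0:ℝ)..a, (G t).toReal| := by
    intro a ha b hb
    rcases le_total a b with hab | hab
    · exact hsub a b ha.1 hab hb.2
    · rw [abs_sub_comm (h b), abs_sub_comm (∫ t in (0:ℝ)..b, (G t).toReal)]
      exact hsub b a hb.1 hab ha.2
  have hAC : AbsolutelyContinuousOnInterval h 0 L := by
    refine (hII.absolutelyContinuousOnInterval_intervalIntegral (c := 0) (by simp)).of_dist_le 1 ?_
    intro s hs t ht
    rw [uIcc_of_le hL] at hs ht
    rw [one_mul, Real.dist_eq, Real.dist_eq]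
    exact hsym t ht s hs
  refine ⟨hAC, ?_⟩
  filter_upwards [hAC.ae_differentiableAt, hII.ae_hasDerivAt_integral] with t h1 h2 ht
  have htI : t ∈ uIcc 0 L := by rw [uIcc_of_le hL]; exact Ioo_subset_Icc_self ht
  have h3 := abs_le_abs_of_hasDerivAt_of_eventually_le (h1 htI).hasDerivAt
    (h2 htI 0 (by simp)) (by
      filter_upwards [Ioo_mem_nhds ht.1 ht.2] with s hs
      exact hsym t (Ioo_subset_Icc_self ht) s (Ioo_subset_Icc_self hs))
  rw [abs_of_nonneg ENNReal.toReal_nonneg] at h3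
  exact (ENNReal.ofReal_le_ofReal h3).trans ENNReal.ofReal_toReal_le

theorem AbsolutelyContinuousOnInterval.ofReal_abs_sub_le_lintegral {h : ℝ → ℝ} {G : ℝ → ℝ≥0∞}
    {L : ℝ} (hL : 0 ≤ L) (hAC : AbsolutelyContinuousOnInterval h 0 L)
    (hG : ∀ᵐ t, t ∈ Ioo 0 L → ENNReal.ofReal |deriv h t| ≤ G t) :
    ENNReal.ofReal |h L - h 0| ≤ ∫⁻ t in Icc 0 L, G t := by
  rw [← hAC.integral_deriv_eq_sub, intervalIntegral.integral_of_le hL,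
    integral_Ioc_eq_integral_Ioo, ← Real.norm_eq_abs, ofReal_norm]
  refine (enorm_integral_le_lintegral_enorm _).trans ?_
  refine le_trans ?_ (lintegral_mono_set Ioo_subset_Icc_self)
  refine setLIntegral_mono_ae' measurableSet_Ioo ?_
  filter_upwards [hG] with t ht hmem
  rw [← ofReal_norm, Real.norm_eq_abs]
  exact ht hmem

variable {X : Type*} [MetricSpace X]

namespace RectCurve

theorem dist_le (γ : RectCurve X) {s t : ℝ} (hs : s ∈ Icc 0 γ.len) (ht : t ∈ Icc 0 γ.len) :
    dist (γ.toFun s) (γ.toFun t) ≤ dist s t := by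
  wlog hst : s ≤ t generalizing s t
  · rw [dist_comm, dist_comm s]
    exact this ht hs (le_of_not_ge hst)
  have h := γ.unitSpeed hs ht
  have h2 := eVariationOn.edist_le γ.toFun (s := Icc 0 γ.len ∩ Icc s t)
    ⟨hs, left_mem_Icc.2 hst⟩ ⟨ht, right_mem_Icc.2 hst⟩
  rw [h, NNReal.coe_one, one_mul, edist_dist] at h2
  rw [dist_comm s, Real.dist_eq, abs_of_nonneg (sub_nonneg.2 hst)]
  exact (ENNReal.ofReal_le_ofReal_iff (sub_nonneg.2 hst)).1 h2

theorem lipschitzOnWith (γ : RectCurve X) : LipschitzOnWith 1 γ.toFun (Icc 0 γ.len) :=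
  LipschitzOnWith.of_dist_le_mul fun s hs t ht => by simpa using γ.dist_le hs ht

theorem aemeasurable_comp [MeasurableSpace X] [BorelSpace X] (γ : RectCurve X)
    {g : X → ℝ≥0∞} (hg : Measurable g) :
    AEMeasurable (fun t => g (γ.toFun t)) (volume.restrict (Icc 0 γ.len)) :=
  hg.comp_aemeasurable (γ.lipschitzOnWith.continuousOn.aemeasurable measurableSet_Icc)

/-- The part of `γ` between the parameters `a` and `b`, parametrized by arc length. -/
def restr (γ : RectCurve X) (a b : ℝ) (ha : 0 ≤ a) (hab : a ≤ b) (hb : b ≤ γ.len) :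
    RectCurve X where
  len := b - a
  toFun t := γ.toFun (a + t)
  len_nonneg := sub_nonneg.2 hab
  unitSpeed := by
    intro s hs t ht
    have hmaps : ∀ r ∈ Icc 0 (b - a), a + r ∈ Icc 0 γ.len := fun r hr =>
      ⟨add_nonneg ha hr.1, by linarith [hr.2]⟩
    have h := γ.unitSpeed (hmaps s hs) (hmaps t ht)
    have hmono : MonotoneOn (fun r : ℝ => a + r) (Icc 0 (b - a)) :=
      fun x _ y _ hxy => by simpa using hxy
    have h2 := eVariationOn.comp_inter_Icc_eq_of_monotoneOn γ.toFun (fun r => a + r) hmono hs ht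
    change eVariationOn (γ.toFun ∘ fun r => a + r) _ = _
    rw [h2, image_const_add_Icc, add_zero, add_sub_cancel]
    rw [show a + t - (a + s) = t - s by ring] at h
    rw [← h]
    congr 1
    ext r
    simp only [mem_inter_iff, mem_Icc] at *
    constructor
    · rintro ⟨⟨_, _⟩, _, _⟩
      exact ⟨⟨by linarith, by linarith⟩, by linarith, by linarith⟩
    · rintro ⟨⟨_, _⟩, _, _⟩
      exact ⟨⟨by linarith, by linarith⟩, by linarith, by linarith⟩

theorem restr_inSet {γ : RectCurve X} {U : Set X} (h : γ.InSet U) {a b : ℝ} (ha : 0 ≤ a)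
    (hab : a ≤ b) (hb : b ≤ γ.len) : (γ.restr a b ha hab hb).InSet U := by
  intro t ht
  change t ∈ Icc 0 (b - a) at ht
  exact h (a + t) ⟨add_nonneg ha ht.1, by linarith [ht.2]⟩

theorem lineIntegral_restr (γ : RectCurve X) (g : X → ℝ≥0∞) {a b : ℝ} (ha : 0 ≤ a)
    (hab : a ≤ b) (hb : b ≤ γ.len) :
    (γ.restr a b ha hab hb).lineIntegral g = ∫⁻ t in Icc a b, g (γ.toFun t) := by
  have h := (measurePreserving_add_left volume a).setLIntegral_comp_preimage_emb
    (MeasurableEquiv.addLeft a).measurableEmbedding (fun t => g (γ.toFun t)) (Icc a b)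
  rw [← h, preimage_const_add_Icc, sub_self]
  rfl

theorem lineIntegral_restr_le (γ : RectCurve X) (g : X → ℝ≥0∞) {a b : ℝ} (ha : 0 ≤ a)
    (hab : a ≤ b) (hb : b ≤ γ.len) :
    (γ.restr a b ha hab hb).lineIntegral g ≤ γ.lineIntegral g := by
  rw [lineIntegral_restr]
  exact lintegral_mono_set (Icc_subset_Icc ha hb)

theorem lineIntegral_mono (γ : RectCurve X) {g h : X → ℝ≥0∞} (hgh : g ≤ h) :
    γ.lineIntegral g ≤ γ.lineIntegral h :=
  lintegral_mono fun _ => hgh _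

/-- The function `u` is absolutely continuous along `γ`, and `g` dominates the modulus of its
derivative almost everywhere on `γ`. -/
def DominatesDeriv (γ : RectCurve X) (u : X → ℝ) (g : X → ℝ≥0∞) : Prop :=
  AbsolutelyContinuousOnInterval (fun t => u (γ.toFun t)) 0 γ.len ∧
    ∀ᵐ t, t ∈ Ioo 0 γ.len → ENNReal.ofReal |deriv (fun t => u (γ.toFun t)) t| ≤ g (γ.toFun t)

theorem DominatesDeriv.upperGradientIneq {γ : RectCurve X} {u : X → ℝ} {g : X → ℝ≥0∞}
    (h : γ.DominatesDeriv u g) : UpperGradientIneq u g γ :=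
  h.1.ofReal_abs_sub_le_lintegral γ.len_nonneg h.2

/-- The inequality for one curve sees only its end points; imposed on every subcurve it controls all
increments, and so the derivative. -/
theorem dominatesDeriv_of_restr [MeasurableSpace X] [BorelSpace X] {γ : RectCurve X}
    {u : X → ℝ} {g : X → ℝ≥0∞} (hg : Measurable g) (hfin : γ.lineIntegral g < ∞)
    (h : ∀ (a b : ℝ) (ha : 0 ≤ a) (hab : a ≤ b) (hb : b ≤ γ.len),
      UpperGradientIneq u g (γ.restr a b ha hab hb)) : γ.DominatesDeriv u g := by
  refine absolutelyContinuous_of_le_lintegral γ.len_nonneg (γ.aemeasurable_comp hg) hfin ?_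
  intro a b ha hab hb
  have h1 := h a b ha hab hb
  unfold UpperGradientIneq at h1
  rw [lineIntegral_restr] at h1
  simpa [restr] using h1

end RectCurve

end

section

/-! ### Exceptional families of curves and minimal weak upper gradients -/

variable {X : Type*} [MetricSpace X] [MeasurableSpace X]

theorem exists_measurable_lintegral_rpow_lt_top {Y : Type*} [MeasurableSpace Y]
    {μ : Measure Y} {p : ℝ} (hp : 0 < p) {ρ : ℕ → Y → ℝ≥0∞} {c : ℕ → ℝ≥0∞} (hρ : ∀ n, Measurable (ρ n))
    (hsum : ∑' n, c n ^ p * ∫⁻ x, ρ n x ^ p ∂μ < ∞) :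
    ∃ σ : Y → ℝ≥0∞, Measurable σ ∧ ∫⁻ x, σ x ^ p ∂μ < ∞ ∧ ∀ n x, c n * ρ n x ≤ σ x := by
  have hm : ∀ n, Measurable fun x => (c n * ρ n x) ^ p := fun n =>
    ((hρ n).const_mul (c n)).pow_const p
  refine ⟨fun x => (∑' n, (c n * ρ n x) ^ p) ^ p⁻¹, (Measurable.tsum hm).pow_const _,
    ?_, fun n x => ?_⟩
  · simp_rw [ENNReal.rpow_inv_rpow hp.ne']
    rw [lintegral_tsum fun n => (hm n).aemeasurable]
    convert hsum using 3 with n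
    simp_rw [ENNReal.mul_rpow_of_nonneg _ _ hp.le]
    rw [lintegral_const_mul _ ((hρ n).pow_const p)]
  · rw [ENNReal.le_rpow_inv_iff hp]
    exact ENNReal.le_tsum (f := fun n => (c n * ρ n x) ^ p) n

/-- Countably many exceptional families are absorbed by one density: the weights c n are small
enough for the energies to sum and nonzero, so finiteness for σ is inherited by every ρ n. -/
theorem exists_lintegral_rpow_lt_top_of_forall {μ : Measure X} {p : ℝ} (hp : 0 < p)
    {ρ : ℕ → X → ℝ≥0∞} (hρ : ∀ n, Measurable (ρ n)) (hfin : ∀ n, ∫⁻ x, ρ n x ^ p ∂μ < ∞) :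
    ∃ σ : X → ℝ≥0∞, Measurable σ ∧ ∫⁻ x, σ x ^ p ∂μ < ∞ ∧
      ∀ γ : RectCurve X, γ.lineIntegral σ < ∞ → ∀ n, γ.lineIntegral (ρ n) < ∞ := by
  obtain ⟨ε, hε, hεs⟩ := ENNReal.exists_pos_sum_of_countable (ε := 1) one_ne_zero ℕ
  let E : ℕ → ℝ≥0∞ := fun n => ∫⁻ x, ρ n x ^ p ∂μ
  have hE : ∀ n, E n + 1 ≠ ∞ := fun n => by simpa using (hfin n).ne
  let c : ℕ → ℝ≥0∞ := fun n => (ε n / (E n + 1)) ^ p⁻¹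
  have hc0 : ∀ n, c n ≠ 0 := fun n => by
    have h : (ε n : ℝ≥0∞) / (E n + 1) ≠ 0 :=
      ENNReal.div_ne_zero.2 ⟨by simpa using (hε n).ne', hE n⟩
    intro h0
    rw [ENNReal.rpow_eq_zero_iff_of_pos (inv_pos.2 hp)] at h0
    exact h h0
  have hctop : ∀ n, c n ≠ ∞ := fun n => by
    refine ENNReal.rpow_ne_top_of_nonneg (inv_pos.2 hp).le (ENNReal.div_ne_top (by simp) ?_)
    simp
  have hsum : ∑' n, c n ^ p * E n < ∞ := by
    refine lt_of_le_of_lt (ENNReal.tsum_le_tsum fun n => ?_) (hεs.trans ENNReal.one_lt_top)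
    simp only [c]
    rw [ENNReal.rpow_inv_rpow hp.ne', ENNReal.div_eq_inv_mul, mul_right_comm]
    refine mul_le_of_le_one_left (zero_le) ?_
    calc (E n + 1)⁻¹ * E n ≤ (E n + 1)⁻¹ * (E n + 1) := by gcongr; exact le_self_add
      _ ≤ 1 := ENNReal.inv_mul_le_one _
  obtain ⟨σ, hσ, hσf, hle⟩ := exists_measurable_lintegral_rpow_lt_top hp hρ hsum
  refine ⟨σ, hσ, hσf, fun γ hγ n => ?_⟩
  have h1 : γ.lineIntegral (fun x => c n * ρ n x) < ∞ :=
    (γ.lineIntegral_mono (hle n)).trans_lt hγ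
  unfold RectCurve.lineIntegral at h1 ⊢
  rw [lintegral_const_mul' _ _ (hctop n)] at h1
  exact ENNReal.lt_top_of_mul_ne_top_right h1.ne (hc0 n)

/-- Fuglede's description of null families. It replaces the infimum by a single density that is
infinite along every exceptional curve. -/
theorem curveModulus_eq_zero_iff {μ : Measure X} {p : ℝ} (hp : 0 < p) {U : Set X}
    {Γ : Set (RectCurve X)} :
    curveModulus μ p U Γ = 0 ↔ ∃ ρ : X → ℝ≥0∞, Measurable ρ ∧ ∫⁻ x in U, ρ x ^ p ∂μ < ∞ ∧
      ∀ γ ∈ Γ, γ.lineIntegral ρ = ∞ := by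
  constructor
  · intro h
    obtain ⟨ε, hε, hεs⟩ := ENNReal.exists_pos_sum_of_countable (ε := 1) one_ne_zero ℕ
    -- The energy bound leaves room for the factor n, so that n * ρ n remains summable while its
    -- line integrals are at least n. At n = 0 the bound is ∞ and the weight is 0.
    have key : ∀ n : ℕ, ∃ ρ : X → ℝ≥0∞, Measurable ρ ∧ (∀ γ ∈ Γ, 1 ≤ γ.lineIntegral ρ) ∧
        ∫⁻ x in U, ρ x ^ p ∂μ < ε n / (n : ℝ≥0∞) ^ p := by
      intro n
      have hpos : 0 < (ε n : ℝ≥0∞) / (n : ℝ≥0∞) ^ p :=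
        ENNReal.div_pos (by simpa using (hε n).ne')
          (ENNReal.rpow_ne_top_of_nonneg hp.le (ENNReal.natCast_ne_top n))
      rw [← h] at hpos
      simp only [curveModulus, iInf_lt_iff] at hpos
      obtain ⟨ρ, h1, h2, h3⟩ := hpos
      exact ⟨ρ, h1, h2, h3⟩
    choose ρ hρ hadm hlt using key
    have hsum : ∑' n : ℕ, (n : ℝ≥0∞) ^ p * ∫⁻ x in U, ρ n x ^ p ∂μ < ∞ := by
      refine lt_of_le_of_lt (ENNReal.tsum_le_tsum fun n => ?_) (hεs.trans ENNReal.one_lt_top)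
      calc (n : ℝ≥0∞) ^ p * ∫⁻ x in U, ρ n x ^ p ∂μ
          ≤ (n : ℝ≥0∞) ^ p * (ε n / (n : ℝ≥0∞) ^ p) := by gcongr; exact (hlt n).le
        _ ≤ ε n := ENNReal.mul_div_le
    obtain ⟨σ, hσ, hσf, hle⟩ := exists_measurable_lintegral_rpow_lt_top hp hρ hsum
    refine ⟨σ, hσ, hσf, fun γ hγ => ?_⟩
    refine ENNReal.eq_top_of_forall_nnreal_le fun r => ?_
    obtain ⟨n, hn⟩ := exists_nat_ge r
    calc (r : ℝ≥0∞) ≤ (n : ℝ≥0∞) := by exact_mod_cast hn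
      _ ≤ n * γ.lineIntegral (ρ n) := le_mul_of_one_le_right (zero_le) (hadm n γ hγ)
      _ = γ.lineIntegral fun x => n * ρ n x := by
        unfold RectCurve.lineIntegral
        rw [lintegral_const_mul' _ _ (ENNReal.natCast_ne_top n)]
      _ ≤ γ.lineIntegral σ := γ.lineIntegral_mono (hle n)
  · rintro ⟨ρ, hρ, hfin, htop⟩
    refine le_antisymm (ENNReal.le_of_forall_pos_le_add fun ε hε _ => ?_) (zero_le)
    rw [zero_add]
    let E := ∫⁻ x in U, ρ x ^ p ∂μ
    have hE : E + 1 ≠ ∞ := by simpa using hfin.ne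
    let c : ℝ≥0∞ := (ε / (E + 1)) ^ p⁻¹
    have hc0 : c ≠ 0 := by
      have h : (ε : ℝ≥0∞) / (E + 1) ≠ 0 := ENNReal.div_ne_zero.2 ⟨by simpa using hε.ne', hE⟩
      intro h0
      rw [ENNReal.rpow_eq_zero_iff_of_pos (inv_pos.2 hp)] at h0
      exact h h0
    have hctop : c ≠ ∞ :=
      ENNReal.rpow_ne_top_of_nonneg (inv_pos.2 hp).le (ENNReal.div_ne_top (by simp) (by simp))
    refine iInf_le_of_le (fun x => c * ρ x) (iInf_le_of_le (hρ.const_mul c)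
      (iInf_le_of_le (fun γ hγ => ?_) ?_))
    · have := htop γ hγ
      unfold RectCurve.lineIntegral at this ⊢
      rw [lintegral_const_mul' _ _ hctop, this, ENNReal.mul_top hc0]
      exact le_top
    · simp_rw [ENNReal.mul_rpow_of_nonneg _ _ hp.le]
      rw [lintegral_const_mul _ (hρ.pow_const p)]
      simp only [c]
      rw [ENNReal.rpow_inv_rpow hp.ne', ENNReal.div_eq_inv_mul, mul_right_comm]
      refine mul_le_of_le_one_left (zero_le) ?_
      calc (E + 1)⁻¹ * E ≤ (E + 1)⁻¹ * (E + 1) := by gcongr; exact le_self_add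
        _ ≤ 1 := ENNReal.inv_mul_le_one _

/-- Along `p`-almost every curve in `U`, the function `u` is absolutely continuous with derivative
dominated by `g`. -/
def DominatesDerivOn (μ : Measure X) (p : ℝ) (U : Set X) (u : X → ℝ) (g : X → ℝ≥0∞) : Prop :=
  ∃ ρ : X → ℝ≥0∞, Measurable ρ ∧ ∫⁻ x in U, ρ x ^ p ∂μ < ∞ ∧
    ∀ γ : RectCurve X, γ.InSet U → γ.lineIntegral ρ < ∞ → γ.DominatesDeriv u g

theorem DominatesDerivOn.isWeakUpperGradientOn {μ : Measure X} {p : ℝ} (hp : 0 < p) {U : Set X}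
    {u : X → ℝ} {g : X → ℝ≥0∞} (h : DominatesDerivOn μ p U u g) (hg : Measurable g) :
    IsWeakUpperGradientOn μ p U u g := by
  obtain ⟨ρ, hρ, hfin, hdom⟩ := h
  refine ⟨hg, (curveModulus_eq_zero_iff hp).2 ⟨ρ, hρ, hfin, fun γ hγ => ?_⟩⟩
  by_contra hne
  exact hγ.2 (hdom γ hγ.1 (lt_top_iff_ne_top.2 hne)).upperGradientIneq

theorem max_rpow_le_add {p : ℝ} (hp : 0 ≤ p) (a b : ℝ≥0∞) : max a b ^ p ≤ a ^ p + b ^ p := by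
  rw [(ENNReal.monotone_rpow_of_nonneg hp).map_max]
  exact max_le le_self_add le_add_self

theorem lintegral_max_rpow_lt_top {Y : Type*} [MeasurableSpace Y]
    {μ : Measure Y} {p : ℝ} (hp : 0 ≤ p) {g h : Y → ℝ≥0∞}
    (hg : Measurable g) (hgf : ∫⁻ x, g x ^ p ∂μ < ∞) (hhf : ∫⁻ x, h x ^ p ∂μ < ∞) :
    ∫⁻ x, max (g x) (h x) ^ p ∂μ < ∞ := by
  refine (lintegral_mono fun x => max_rpow_le_add hp (g x) (h x)).trans_lt ?_
  rw [lintegral_add_left (hg.pow_const p)]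
  exact ENNReal.add_lt_top.2 ⟨hgf, hhf⟩

/-- If ρ has finite integral along γ, it has finite integral along each subcurve, so no subcurve is
exceptional. Taking the maximum with g also makes g integrable along γ. -/
theorem IsWeakUpperGradientOn.dominatesDerivOn [BorelSpace X] {μ : Measure X} {p : ℝ}
    (hp : 0 < p) {U : Set X} {u : X → ℝ} {g : X → ℝ≥0∞} (h : IsWeakUpperGradientOn μ p U u g)
    (hfin : ∫⁻ x in U, g x ^ p ∂μ < ∞) : DominatesDerivOn μ p U u g := by
  obtain ⟨hg, hmod⟩ := h
  obtain ⟨ρ, hρ, hρf, htop⟩ := (curveModulus_eq_zero_iff hp).1 hmod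
  refine ⟨fun x => max (ρ x) (g x), hρ.max hg, lintegral_max_rpow_lt_top hp.le hρ hρf hfin,
    fun γ hγ hlt => ?_⟩
  refine RectCurve.dominatesDeriv_of_restr hg
    ((γ.lineIntegral_mono fun x => le_max_right _ _).trans_lt hlt) fun a b ha hab hb => ?_
  by_contra hne
  have h1 := htop _ ⟨RectCurve.restr_inSet hγ ha hab hb, hne⟩
  have h2 := (γ.lineIntegral_restr_le ρ ha hab hb).trans
    (γ.lineIntegral_mono fun x => le_max_left (ρ x) (g x))
  exact (h2.trans_lt hlt).ne h1

theorem IsUpperGradientOn.isWeakUpperGradientOn {μ : Measure X} {p : ℝ} (hp : 0 < p) {U : Set X}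
    {u : X → ℝ} {g : X → ℝ≥0∞} (h : IsUpperGradientOn U u g) :
    IsWeakUpperGradientOn μ p U u g := by
  refine ⟨h.1, (curveModulus_eq_zero_iff hp).2 ⟨fun _ => 0, measurable_const, ?_, ?_⟩⟩
  · simp [hp]
  · rintro γ ⟨h1, h2⟩
    exact (h2 (h.2 γ h1)).elim

theorem DominatesDerivOn.exists_isUpperGradientOn {μ : Measure X} {p : ℝ} (hp : 0 < p)
    {U : Set X} {u : X → ℝ} {g : X → ℝ≥0∞} (h : DominatesDerivOn μ p U u g) (hg : Measurable g)
    (hfin : ∫⁻ x in U, g x ^ p ∂μ < ∞) :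
    ∃ g' : X → ℝ≥0∞, IsUpperGradientOn U u g' ∧ ∫⁻ x in U, g' x ^ p ∂μ < ∞ := by
  obtain ⟨ρ, hρ, hρf, hdom⟩ := h
  refine ⟨fun x => max (ρ x) (g x), ⟨hρ.max hg, fun γ hγ => ?_⟩,
    lintegral_max_rpow_lt_top hp.le hρ hρf hfin⟩
  rcases lt_or_ge (γ.lineIntegral ρ) ∞ with hlt | hge
  · exact (hdom γ hγ hlt).upperGradientIneq.trans (γ.lineIntegral_mono fun x => le_max_right _ _)
  · exact le_top.trans (hge.trans (γ.lineIntegral_mono fun x => le_max_left _ _))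

/-- Along a good curve the countably many almost everywhere bounds on the same derivative hold
simultaneously. -/
theorem DominatesDerivOn.iInf {μ : Measure X} {p : ℝ} (hp : 0 < p) {U : Set X} {u : X → ℝ}
    {g : ℕ → X → ℝ≥0∞} (h : ∀ n, DominatesDerivOn μ p U u (g n)) :
    DominatesDerivOn μ p U u (fun x => ⨅ n, g n x) := by
  choose ρ hρ hρf hdom using h
  obtain ⟨σ, hσ, hσf, hfin⟩ := exists_lintegral_rpow_lt_top_of_forall hp hρ hρf
  refine ⟨σ, hσ, hσf, fun γ hγ hlt => ⟨(hdom 0 γ hγ (hfin γ hlt 0)).1, ?_⟩⟩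
  have hall := ae_all_iff.2 fun n => (hdom n γ hγ (hfin γ hlt n)).2
  filter_upwards [hall] with t ht hmem
  exact le_iInf fun n => ht n hmem

/-- The infimum G of an energy-minimizing sequence is still admissible. For any other admissible h,
so is min(G, h); its energy cannot be smaller than that of G, which forces G ≤ h almost everywhere.
-/
theorem exists_isMinimalWeakUpperGradientOn [BorelSpace X] {μ : Measure X} {p : ℝ} (hp : 0 < p)
    {U : Set X} {u : X → ℝ} (hex : ∃ g : X → ℝ≥0∞, Measurable g ∧ DominatesDerivOn μ p U u g ∧
      ∫⁻ x in U, g x ^ p ∂μ < ∞) :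
    ∃ g, IsMinimalWeakUpperGradientOn μ p U u g := by
  let S : Set (X → ℝ≥0∞) := {g | Measurable g ∧ DominatesDerivOn μ p U u g ∧
      ∫⁻ x in U, g x ^ p ∂μ < ∞}
  let E : (X → ℝ≥0∞) → ℝ≥0∞ := fun g => ∫⁻ x in U, g x ^ p ∂μ
  have hne : (E '' S).Nonempty := (show S.Nonempty from hex).image E
  obtain ⟨e, -, he, heS⟩ := exists_seq_tendsto_sInf hne (OrderBot.bddBelow _)
  choose g hgS hge using heS
  have hiInf : ∀ g : ℕ → X → ℝ≥0∞, (∀ n, g n ∈ S) → (fun x => ⨅ n, g n x) ∈ S := by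
    refine fun g hg => ⟨Measurable.iInf fun n => (hg n).1, DominatesDerivOn.iInf hp fun n =>
      (hg n).2.1, lt_of_le_of_lt (lintegral_mono fun x => ?_) (hg 0).2.2⟩
    exact ENNReal.rpow_le_rpow (iInf_le _ 0) hp.le
  let G : X → ℝ≥0∞ := fun x => ⨅ n, g n x
  have hG : G ∈ S := hiInf g hgS
  have hGle : E G ≤ sInf (E '' S) := by
    refine ge_of_tendsto' he fun n => ?_
    rw [← hge n]
    exact lintegral_mono fun x => ENNReal.rpow_le_rpow (iInf_le _ n) hp.le
  refine ⟨G, hG.2.1.isWeakUpperGradientOn hp hG.1, hG.2.2, fun h hh hhf => ?_⟩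
  have hhS : h ∈ S := ⟨hh.1, hh.dominatesDerivOn hp hhf, hhf⟩
  let k : ℕ → X → ℝ≥0∞ := fun n => if n = 0 then G else h
  have hk : (fun x => ⨅ n, k n x) ∈ S := hiInf k fun n => by
    by_cases hn : n = 0
    · simpa [k, hn] using hG
    · simpa [k, hn] using hhS
  have hkG : ∀ x, ⨅ n, k n x ≤ G x := fun x => (iInf_le _ 0).trans (by simp [k])
  have hkh : ∀ x, ⨅ n, k n x ≤ h x := fun x => (iInf_le _ 1).trans (by simp [k])
  have hae := ae_eq_of_ae_le_of_lintegral_le (μ := μ.restrict U)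
    (f := fun x => (⨅ n, k n x) ^ p) (g := fun x => G x ^ p)
    (Eventually.of_forall fun x => ENNReal.rpow_le_rpow (hkG x) hp.le) hk.2.2.ne
    (hG.1.pow_const p).aemeasurable (hGle.trans (csInf_le (OrderBot.bddBelow _) ⟨_, hk, rfl⟩))
  filter_upwards [hae] with x hx
  rw [← (ENNReal.strictMono_rpow_of_pos hp).injective hx]
  exact hkh x

theorem minWeakUpperGradient_spec [BorelSpace X] {μ : Measure X} {p : ℝ} (hp : 0 < p)
    {U : Set X} {u : X → ℝ} (hex : ∃ g : X → ℝ≥0∞, Measurable g ∧ DominatesDerivOn μ p U u g ∧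
      ∫⁻ x in U, g x ^ p ∂μ < ∞) :
    IsMinimalWeakUpperGradientOn μ p U u (minWeakUpperGradient μ p U u) := by
  have h := exists_isMinimalWeakUpperGradientOn hp hex
  rw [minWeakUpperGradient, dif_pos h]
  exact h.choose_spec

theorem MemNewtonian.minWeakUpperGradient_spec [BorelSpace X] {μ : Measure X} {p : ℝ}
    (hp : 0 < p) {U : Set X} {u : X → ℝ} (hu : MemNewtonian μ p U u) :
    IsMinimalWeakUpperGradientOn μ p U u (minWeakUpperGradient μ p U u) := by
  obtain ⟨-, g, hg, hfin⟩ := hu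
  exact _root_.minWeakUpperGradient_spec hp
    ⟨g, hg.1, (hg.isWeakUpperGradientOn hp).dominatesDerivOn hp hfin, hfin⟩

theorem minWeakUpperGradient_ae_le [BorelSpace X] {μ : Measure X} {p : ℝ} (hp : 0 < p)
    {U : Set X} {u : X → ℝ} {g : X → ℝ≥0∞} (hg : Measurable g) (h : DominatesDerivOn μ p U u g)
    (hfin : ∫⁻ x in U, g x ^ p ∂μ < ∞) :
    ∀ᵐ x ∂(μ.restrict U), minWeakUpperGradient μ p U u x ≤ g x :=
  (minWeakUpperGradient_spec hp ⟨g, hg, h, hfin⟩).2.2 g (h.isWeakUpperGradientOn hp hg) hfin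

end

section

/-! ### Truncations and cutoffs of Newtonian functions -/

theorem abs_rpow_sub_rpow_le_of_mem_Icc {p : ℝ} (hp : 1 ≤ p) {a b : ℝ} (ha : a ∈ Icc (0 : ℝ) 1)
    (hb : b ∈ Icc (0 : ℝ) 1) : |a ^ p - b ^ p| ≤ p * |a - b| := by
  have h := (convex_Icc (0 : ℝ) 1).norm_image_sub_le_of_norm_hasDerivWithin_le
    (f := fun x : ℝ => x ^ p) (f' := fun x => p * x ^ (p - 1)) (C := p)
    (fun x _ => (Real.hasDerivAt_rpow_const (Or.inr hp)).hasDerivWithinAt) (fun x hx => ?_) hb ha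
  · simpa [Real.norm_eq_abs] using h
  · rw [Real.norm_eq_abs, abs_of_nonneg (mul_nonneg (by linarith) (Real.rpow_nonneg hx.1 _))]
    exact mul_le_of_le_one_right (by linarith) (Real.rpow_le_one hx.1 hx.2 (by linarith))

theorem abs_max_sub_max_le_abs_sub (a b k : ℝ) :
    |max (a - k) 0 - max (b - k) 0| ≤ |a - b| := by
  simpa using abs_max_sub_max_le_abs (a - k) (b - k) 0

variable {X : Type*} [MetricSpace X]

theorem RectCurve.DominatesDeriv.max_sub {γ : RectCurve X} {U : Set X} (hγ : γ.InSet U)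
    {u : X → ℝ} {g G : X → ℝ≥0∞} (h : γ.DominatesDeriv u g) (k : ℝ)
    (hG : ∀ x ∈ U, k < u x → g x ≤ G x) :
    γ.DominatesDeriv (fun x => max (u x - k) 0) G := by
  have hAC : AbsolutelyContinuousOnInterval (fun t => max (u (γ.toFun t) - k) 0) 0 γ.len := by
    refine h.1.of_dist_le 1 fun s _ t _ => ?_
    rw [one_mul, Real.dist_eq, Real.dist_eq]
    exact abs_max_sub_max_le_abs_sub _ _ _
  refine ⟨hAC, ?_⟩
  filter_upwards [h.2, h.1.ae_differentiableAt] with t ht hd hmem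
  have htI : t ∈ Icc 0 γ.len := Ioo_subset_Icc_self hmem
  have hcont : ContinuousAt (fun t => u (γ.toFun t)) t :=
    (hd (by rwa [uIcc_of_le γ.len_nonneg])).continuousAt
  rcases le_or_gt (u (γ.toFun t)) k with hle | hlt
  -- Where u ≤ k the truncation attains its minimum, so its derivative vanishes and nothing is
  -- required of G there.
  · have hmin : IsLocalMin (fun t => max (u (γ.toFun t) - k) 0) t := by
      refine Eventually.of_forall fun s => ?_
      simp only [max_eq_right (sub_nonpos.2 hle)]
      exact le_max_right _ _
    rw [hmin.deriv_eq_zero]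
    simp
  · have heq : (fun t => max (u (γ.toFun t) - k) 0) =ᶠ[𝓝 t] fun t => u (γ.toFun t) - k := by
      filter_upwards [hcont.eventually_const_lt hlt] with s hs
      exact max_eq_left (sub_nonneg.2 hs.le)
    rw [heq.deriv_eq, deriv_sub_const]
    exact (ht hmem).trans (hG _ (hγ t htI) hlt)

theorem RectCurve.DominatesDeriv.sub_cutoff {γ : RectCurve X} {U : Set X} (hγ : γ.InSet U)
    {u ψ : X → ℝ} {g G : X → ℝ≥0∞} (h : γ.DominatesDeriv u g) {p : ℝ} (hp : 1 ≤ p) (k : ℝ)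
    {K : ℝ≥0} (hψ : LipschitzWith K ψ) (hψI : ∀ x, ψ x ∈ Icc (0 : ℝ) 1)
    (hG : ∀ x ∈ U, u x ≤ k → g x ≤ G x)
    (hG' : ∀ x ∈ U, k < u x → ENNReal.ofReal (1 - ψ x ^ p) * g x +
      ENNReal.ofReal (p * ψ x ^ (p - 1) * K * (u x - k)) ≤ G x) :
    γ.DominatesDeriv (fun x => u x - ψ x ^ p * max (u x - k) 0) G := by
  have hψ1 : ∀ s ∈ Icc 0 γ.len, ∀ t ∈ Icc 0 γ.len,
      |ψ (γ.toFun s) - ψ (γ.toFun t)| ≤ |K * s - K * t| := by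
    intro s hs t ht
    rw [← mul_sub, abs_mul, NNReal.abs_eq, ← Real.dist_eq, ← Real.dist_eq]
    exact (hψ.dist_le_mul _ _).trans (by gcongr; exact γ.dist_le hs ht)
  have hmaxAC : AbsolutelyContinuousOnInterval (fun t => max (u (γ.toFun t) - k) 0) 0 γ.len := by
    refine h.1.of_dist_le 1 fun s _ t _ => ?_
    rw [one_mul, Real.dist_eq, Real.dist_eq]
    exact abs_max_sub_max_le_abs_sub _ _ _
  have hψAC : AbsolutelyContinuousOnInterval (fun t => ψ (γ.toFun t)) 0 γ.len := by
    refine LipschitzOnWith.absolutelyContinuousOnInterval (K := K * 1) ?_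
    rw [uIcc_of_le γ.len_nonneg]
    exact (hψ.lipschitzOnWith (s := univ)).comp γ.lipschitzOnWith (mapsTo_univ _ _)
  have hψpAC : AbsolutelyContinuousOnInterval (fun t => ψ (γ.toFun t) ^ p) 0 γ.len := by
    refine hψAC.of_dist_le p fun s _ t _ => ?_
    exact abs_rpow_sub_rpow_le_of_mem_Icc hp (hψI _) (hψI _)
  have hAC := h.1.fun_sub (hψpAC.mul hmaxAC)
  refine ⟨hAC, ?_⟩
  filter_upwards [h.2, h.1.ae_differentiableAt, hψAC.ae_differentiableAt, hAC.ae_differentiableAt]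
    with t ht hd hdψ hdv hmem
  have htI : t ∈ Icc 0 γ.len := Ioo_subset_Icc_self hmem
  rw [uIcc_of_le γ.len_nonneg] at hd hdψ hdv
  specialize hd htI
  specialize hdψ htI
  specialize hdv htI
  specialize ht hmem
  have hη : ∀ x, 0 ≤ ψ x ^ p ∧ ψ x ^ p ≤ 1 := fun x =>
    ⟨Real.rpow_nonneg (hψI x).1 _, Real.rpow_le_one (hψI x).1 (hψI x).2 (by linarith)⟩
  rcases lt_trichotomy (u (γ.toFun t)) k with hlt | heq | hgt
  · have hev : (fun t => u (γ.toFun t) - ψ (γ.toFun t) ^ p * max (u (γ.toFun t) - k) 0) =ᶠ[𝓝 t]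
        fun t => u (γ.toFun t) := by
      filter_upwards [hd.continuousAt.eventually_lt_const hlt] with s hs
      rw [max_eq_right (sub_nonpos.2 hs.le), mul_zero, sub_zero]
    rw [hev.deriv_eq]
    exact ht.trans (hG _ (hγ t htI) hlt.le)
  -- At level k the truncation may have a kink, so the product rule is avoided: the increments of v
  -- from this point are at most those of u, because 0 ≤ 1 - ψ^p ≤ 1.
  · refine le_trans (ENNReal.ofReal_le_ofReal ?_) (ht.trans (hG _ (hγ t htI) heq.le))
    refine abs_le_abs_of_hasDerivAt_of_eventually_le hdv.hasDerivAt hd.hasDerivAt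
      (Eventually.of_forall fun s => ?_)
    simp only [Pi.mul_apply, heq, sub_self, max_self, mul_zero, sub_zero]
    obtain ⟨h0, h1⟩ := hη (γ.toFun s)
    rcases le_total (u (γ.toFun s)) k with hs | hs
    · rw [max_eq_right (sub_nonpos.2 hs), mul_zero, sub_zero]
    · rw [max_eq_left (sub_nonneg.2 hs), show u (γ.toFun s) - ψ (γ.toFun s) ^ p *
        (u (γ.toFun s) - k) - k = (1 - ψ (γ.toFun s) ^ p) * (u (γ.toFun s) - k) by ring,
        abs_mul, abs_of_nonneg (sub_nonneg.2 h1)]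
      exact mul_le_of_le_one_left (abs_nonneg _) (by linarith)
  · have hev : (fun t => u (γ.toFun t) - ψ (γ.toFun t) ^ p * max (u (γ.toFun t) - k) 0) =ᶠ[𝓝 t]
        fun t => u (γ.toFun t) - ψ (γ.toFun t) ^ p * (u (γ.toFun t) - k) := by
      filter_upwards [hd.continuousAt.eventually_const_lt hgt] with s hs
      rw [max_eq_left (sub_nonneg.2 hs.le)]
    rw [hev.deriv_eq]
    have hder := hd.hasDerivAt.fun_sub ((hdψ.hasDerivAt.rpow_const (Or.inr hp)).fun_mul
      (hd.hasDerivAt.sub_const k))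
    rw [hder.deriv]
    have hψ' : |deriv (fun t => ψ (γ.toFun t)) t| ≤ K := by
      have := abs_le_abs_of_hasDerivAt_of_eventually_le hdψ.hasDerivAt
        ((hasDerivAt_id t).const_mul (K : ℝ)) (by
          filter_upwards [Ioo_mem_nhds hmem.1 hmem.2] with s hs
          exact hψ1 s (Ioo_subset_Icc_self hs) t htI)
      simpa using this
    obtain ⟨h0, h1⟩ := hη (γ.toFun t)
    have hq : 0 ≤ ψ (γ.toFun t) ^ (p - 1) := Real.rpow_nonneg (hψI _).1 _
    refine le_trans ?_ (hG' _ (hγ t htI) hgt)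
    refine le_trans ?_ (add_le_add_left (mul_le_mul_right ht _) _)
    rw [← ENNReal.ofReal_mul (by linarith), ← ENNReal.ofReal_add
      (mul_nonneg (by linarith) (abs_nonneg _)) (by
        have := sub_pos.2 hgt
        positivity)]
    refine ENNReal.ofReal_le_ofReal ?_
    generalize deriv (fun t => u (γ.toFun t)) t = a
    generalize deriv (fun t => ψ (γ.toFun t)) t = b at hψ'
    rw [show a - (b * p * ψ (γ.toFun t) ^ (p - 1) * (u (γ.toFun t) - k) + ψ (γ.toFun t) ^ p * a) =
      (1 - ψ (γ.toFun t) ^ p) * a - p * ψ (γ.toFun t) ^ (p - 1) * b * (u (γ.toFun t) - k) by ring]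
    refine (abs_sub _ _).trans ?_
    rw [abs_mul, abs_of_nonneg (sub_nonneg.2 h1), abs_mul, abs_mul, abs_mul, abs_of_nonneg hq,
      abs_of_nonneg (sub_pos.2 hgt).le, abs_of_nonneg (by linarith : 0 ≤ p)]
    have := (sub_pos.2 hgt).le
    gcongr

/-- Writing p s^(p-1) K w as s^p times p K w / s exhibits a convex combination; raising the second
entry to the power p produces s^(-p), which cancels its weight. At s = 0 the second term is absent,
which confines it to the support of the cutoff. -/
theorem rpow_cutoff_convexity {p : ℝ} (hp : 1 < p) {s w : ℝ} {K : ℝ≥0}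
    (hs : s ∈ Icc (0 : ℝ) 1) (hw : 0 ≤ w) (a : ℝ≥0∞) :
    (ENNReal.ofReal (1 - s ^ p) * a + ENNReal.ofReal (p * s ^ (p - 1) * K * w)) ^ p ≤
      ENNReal.ofReal (1 - s ^ p) * a ^ p +
        if s = 0 then 0 else ENNReal.ofReal ((p * K) ^ p) * ENNReal.ofReal (w ^ p) := by
  have hp0 : 0 < p := by linarith
  rcases eq_or_ne s 0 with rfl | hs0
  · simp [Real.zero_rpow hp0.ne', Real.zero_rpow (sub_pos.2 hp).ne']
  · have hspos : 0 < s := lt_of_le_of_ne hs.1 hs0.symm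
    have h0 : 0 ≤ s ^ p := Real.rpow_nonneg hs.1 _
    have h1 : s ^ p ≤ 1 := Real.rpow_le_one hs.1 hs.2 hp0.le
    have hz : 0 ≤ p * K * w / s := by positivity
    have h := ENNReal.rpow_arith_mean_le_arith_mean2_rpow (ENNReal.ofReal (1 - s ^ p))
      (ENNReal.ofReal (s ^ p)) a (ENNReal.ofReal (p * K * w / s))
      (by rw [← ENNReal.ofReal_add (by linarith) h0]; simp) hp.le
    rw [if_neg hs0]
    convert h using 2
    · congr 1
      rw [← ENNReal.ofReal_mul h0]
      congr 1
      rw [Real.rpow_sub_one hs0]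
      field_simp
    · rw [← ENNReal.ofReal_mul (by positivity), ENNReal.ofReal_rpow_of_nonneg hz hp0.le,
        ← ENNReal.ofReal_mul h0, Real.div_rpow (by positivity) hs.1,
        Real.mul_rpow (by positivity) hw]
      congr 1
      field_simp

variable [MeasurableSpace X]

theorem DominatesDerivOn.mono_curve {μ : Measure X} {p : ℝ} {U : Set X} {u v : X → ℝ}
    {g G : X → ℝ≥0∞} (h : DominatesDerivOn μ p U u g)
    (himp : ∀ γ : RectCurve X, γ.InSet U → γ.DominatesDeriv u g → γ.DominatesDeriv v G) :
    DominatesDerivOn μ p U v G := by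
  obtain ⟨ρ, hρ, hfin, hdom⟩ := h
  exact ⟨ρ, hρ, hfin, fun γ hγ hlt => himp γ hγ (hdom γ hγ hlt)⟩

theorem memLp_max_sub {Y : Type*} [MeasurableSpace Y] {μ : Measure Y}
    [IsFiniteMeasure μ] {q : ℝ≥0∞} {u : Y → ℝ}
    (hu : MemLp u q μ) (k : ℝ) : MemLp (fun x => max (u x - k) 0) q μ := by
  refine (hu.sub (memLp_const k)).of_le
    ((hu.1.sub aestronglyMeasurable_const).sup aestronglyMeasurable_const)
    (Eventually.of_forall fun x => ?_)
  rw [Real.norm_eq_abs, Real.norm_eq_abs, abs_of_nonneg (le_max_right _ _)]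
  exact max_le (le_abs_self _) (abs_nonneg _)

theorem lintegral_ofReal_rpow_lt_top {Y : Type*} [MeasurableSpace Y] {μ : Measure Y}
    {p : ℝ} (hp : 0 < p) {w : Y → ℝ} (hw : MemLp w (ENNReal.ofReal p) μ) (h0 : ∀ x, 0 ≤ w x) :
    ∫⁻ x, ENNReal.ofReal (w x ^ p) ∂μ < ∞ := by
  have h := lintegral_rpow_enorm_lt_top_of_eLpNorm_lt_top (by simpa using hp)
    ENNReal.ofReal_ne_top hw.2
  rw [ENNReal.toReal_ofReal hp.le] at h
  convert h using 3 with x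
  rw [Real.enorm_of_nonneg (h0 x), ENNReal.ofReal_rpow_of_nonneg (h0 x) hp.le]

/-- The interior part of the argument. Minimality enters only through D, the amount by which the
energy of u may exceed that of the competitor. -/
theorem cutoff_memNewtonian_and_caccioppoli [BorelSpace X] {μ : Measure X} {p : ℝ} (hp : 1 < p)
    {Ω : Set X} (hμΩ : μ Ω ≠ ∞) {u ψ : X → ℝ}
    (hu : MemNewtonian μ p Ω u) (k : ℝ) {K : ℝ≥0} (hψ : LipschitzWith K ψ)
    (hψI : ∀ x, ψ x ∈ Icc (0 : ℝ) 1) {s t : Set X} (hsm : MeasurableSet s)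
    (htm : MeasurableSet t) (hs : ∀ x ∈ s, ψ x = 1) (ht : ∀ x ∉ t, ψ x = 0) :
    MemNewtonian μ p Ω (fun x => u x - ψ x ^ p * max (u x - k) 0) ∧
    ∀ D : ℝ≥0∞, ∫⁻ x in Ω, minWeakUpperGradient μ p Ω u x ^ p ∂μ ≤
        ∫⁻ x in Ω, minWeakUpperGradient μ p Ω
          (fun x => u x - ψ x ^ p * max (u x - k) 0) x ^ p ∂μ + D →
      ∫⁻ x in Ω ∩ s, minWeakUpperGradient μ p Ω (fun x => max (u x - k) 0) x ^ p ∂μ ≤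
        ENNReal.ofReal ((p * K) ^ p) *
          ∫⁻ x in Ω ∩ t, ENNReal.ofReal (max (u x - k) 0 ^ p) ∂μ + D := by
  classical
  have hp0 : 0 < p := by linarith
  have : IsFiniteMeasure (μ.restrict Ω) := ⟨by simpa [lt_top_iff_ne_top] using hμΩ⟩
  obtain ⟨hgw, hgfin, -⟩ := hu.minWeakUpperGradient_spec hp0
  have hdom := hgw.dominatesDerivOn hp0 hgfin
  set g := minWeakUpperGradient μ p Ω u with hgdef
  have hgm : Measurable g := hgw.1
  obtain ⟨u', hu'm, huu'⟩ := hu.1.1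
  have hu'm' : Measurable u' := hu'm.measurable
  set N : Set X := toMeasurable (μ.restrict Ω) {x | ¬ u x = u' x} with hN
  have hNm : MeasurableSet N := measurableSet_toMeasurable _ _
  have hN0 : ∀ᵐ x ∂(μ.restrict Ω), x ∉ N := by
    have : (μ.restrict Ω) N = 0 := by rw [hN, measure_toMeasurable]; exact ae_iff.1 huu'
    exact measure_eq_zero_iff_ae_notMem.1 this
  have hNu : ∀ x ∉ N, u x = u' x := fun x hx => by
    by_contra hne
    exact hx (subset_toMeasurable _ _ hne)
  have hψm : Measurable ψ := hψ.continuous.measurable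
  let w : X → ℝ := fun x => max (u' x - k) 0
  have hwm : Measurable w := (hu'm'.sub_const k).max measurable_const
  -- The cutoff weight restricted to {u' > k}: this fraction of g^p is what the competitor removes
  -- and what the final estimate retains.
  let θ : X → ℝ := fun x => if k < u' x then ψ x ^ p else 0
  have hset : MeasurableSet {x | k < u' x} := measurableSet_lt measurable_const hu'm'
  have hθm : Measurable θ := Measurable.ite hset (hψm.pow_const p) measurable_const
  have hη : ∀ x, 0 ≤ ψ x ^ p ∧ ψ x ^ p ≤ 1 := fun x =>
    ⟨Real.rpow_nonneg (hψI x).1 _, Real.rpow_le_one (hψI x).1 (hψI x).2 hp0.le⟩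
  have hθ : ∀ x, 0 ≤ θ x ∧ θ x ≤ 1 := fun x => by
    by_cases hx : k < u' x
    · simpa [θ, hx] using hη x
    · simp [θ, hx]
  let G₀ : X → ℝ≥0∞ := fun x => ENNReal.ofReal (1 - θ x) * g x +
    ENNReal.ofReal (p * ψ x ^ (p - 1) * K * w x)
  have hG₀m : Measurable G₀ := ((measurable_const.sub hθm).ennreal_ofReal.mul hgm).add
    ((((hψm.pow_const _).const_mul p).mul_const _).mul hwm).ennreal_ofReal
  let G : X → ℝ≥0∞ := fun x => if x ∈ N then ∞ else G₀ x
  have hGm : Measurable G := Measurable.ite hNm measurable_const hG₀m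
  have hvdom : DominatesDerivOn μ p Ω (fun x => u x - ψ x ^ p * max (u x - k) 0) G := by
    refine hdom.mono_curve fun γ hγ h => h.sub_cutoff hγ hp.le k hψ hψI ?_ ?_
    · intro x _ hle
      by_cases hx : x ∈ N
      · simp [G, hx]
      · have h1 : ¬ k < u' x := by rw [← hNu x hx]; exact not_lt.2 hle
        simp [G, hx, G₀, θ, h1]
    · intro x _ hlt
      by_cases hx : x ∈ N
      · simp [G, hx]
      · have h1 : k < u' x := by rwa [← hNu x hx]
        simp only [G, hx, if_false, G₀, θ, h1, if_true, w]
        rw [hNu x hx, max_eq_left (sub_nonneg.2 h1.le)]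
  let M : ℝ≥0∞ := ENNReal.ofReal ((p * K) ^ p) *
    ∫⁻ x in Ω ∩ t, ENNReal.ofReal (max (u x - k) 0 ^ p) ∂μ
  let A : ℝ≥0∞ := ∫⁻ x in Ω, ENNReal.ofReal (1 - θ x) * g x ^ p ∂μ
  let B : ℝ≥0∞ := ∫⁻ x in Ω, ENNReal.ofReal (θ x) * g x ^ p ∂μ
  have hAB : ∫⁻ x in Ω, g x ^ p ∂μ = B + A := by
    have hm : Measurable fun x => ENNReal.ofReal (θ x) * g x ^ p :=
      hθm.ennreal_ofReal.mul (hgm.pow_const p)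
    rw [← lintegral_add_left hm]
    refine lintegral_congr fun x => ?_
    rw [← add_mul, ← ENNReal.ofReal_add (hθ x).1 (sub_nonneg.2 (hθ x).2)]
    simp
  have hAfin : A ≠ ∞ := ((le_add_left le_rfl).trans_lt (hAB ▸ hgfin)).ne
  have hGint : ∫⁻ x in Ω, G x ^ p ∂μ ≤ A + M := by
    have hpt : ∀ᵐ x ∂(μ.restrict Ω), G x ^ p ≤ ENNReal.ofReal (1 - θ x) * g x ^ p +
        t.indicator (fun x => ENNReal.ofReal ((p * K) ^ p) *
          ENNReal.ofReal (max (u x - k) 0 ^ p)) x := by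
      filter_upwards [hN0] with x hx
      have hux := hNu x hx
      simp only [G, hx, if_false, G₀]
      by_cases h1 : k < u' x
      · have hθx : θ x = ψ x ^ p := by simp [θ, h1]
        rw [hθx]
        refine (rpow_cutoff_convexity hp (hψI x) (le_max_right _ _) (g x)).trans ?_
        gcongr
        split_ifs with h2
        · exact zero_le
        · have hxt : x ∈ t := by
            by_contra hxt
            exact h2 (ht x hxt)
          simp [hxt, hux]
      · have hθx : θ x = 0 := by simp [θ, h1]
        have hwx : w x = 0 := max_eq_right (sub_nonpos.2 (not_lt.1 h1))
        simp [hθx, hwx]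
    refine (lintegral_mono_ae hpt).trans ?_
    have hm : Measurable fun x => ENNReal.ofReal (1 - θ x) * g x ^ p :=
      (measurable_const.sub hθm).ennreal_ofReal.mul (hgm.pow_const p)
    rw [lintegral_add_left hm,
      setLIntegral_indicator htm, lintegral_const_mul' _ _ ENNReal.ofReal_ne_top, inter_comm]
  have hwLp := memLp_max_sub hu.1 k
  have hMfin : M < ∞ := by
    refine ENNReal.mul_lt_top ENNReal.ofReal_lt_top ?_
    exact (lintegral_mono_set inter_subset_left).trans_lt
      (lintegral_ofReal_rpow_lt_top hp0 hwLp fun x => le_max_right _ _)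
  have hGfin : ∫⁻ x in Ω, G x ^ p ∂μ < ∞ :=
    hGint.trans_lt (ENNReal.add_lt_top.2 ⟨hAfin.lt_top, hMfin⟩)
  refine ⟨⟨?_, hvdom.exists_isUpperGradientOn hp0 hGm hGfin⟩, fun D hD => ?_⟩
  · refine hu.1.sub (hwLp.of_le ((hψm.pow_const p).aestronglyMeasurable.mul hwLp.1)
      (Eventually.of_forall fun x => ?_))
    rw [norm_mul, Real.norm_of_nonneg (hη x).1]
    exact mul_le_of_le_one_left (norm_nonneg _) (hη x).2
  · have hgv : ∫⁻ x in Ω, minWeakUpperGradient μ p Ω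
        (fun x => u x - ψ x ^ p * max (u x - k) 0) x ^ p ∂μ ≤ A + M := by
      refine le_trans (lintegral_mono_ae ?_) hGint
      filter_upwards [minWeakUpperGradient_ae_le hp0 hGm hvdom hGfin] with x hx
      exact ENNReal.rpow_le_rpow hx hp0.le
    have hB : B ≤ M + D := by
      have h1 := hD.trans (add_le_add_left hgv D)
      rw [hAB, add_comm B A, add_assoc] at h1
      exact (ENNReal.add_le_add_iff_left hAfin).1 h1
    refine le_trans ?_ hB
    let H : X → ℝ≥0∞ := fun x => if x ∈ N then ∞ else if k < u' x then g x else 0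
    have hHm : Measurable H :=
      Measurable.ite hNm measurable_const (Measurable.ite hset hgm measurable_const)
    have hHdom : DominatesDerivOn μ p Ω (fun x => max (u x - k) 0) H := by
      refine hdom.mono_curve fun γ hγ h => h.max_sub hγ k fun x _ hlt => ?_
      by_cases hx : x ∈ N
      · simp [H, hx]
      · have h1 : k < u' x := by rwa [← hNu x hx]
        simp [H, hx, h1]
    have hHle : ∀ᵐ x ∂(μ.restrict Ω), H x ≤ g x := by
      filter_upwards [hN0] with x hx
      simp only [H, hx, if_false]
      split_ifs
      · exact le_rfl
      · exact zero_le
    have hHfin : ∫⁻ x in Ω, H x ^ p ∂μ < ∞ := by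
      refine (lintegral_mono_ae ?_).trans_lt hgfin
      filter_upwards [hHle] with x hx
      exact ENNReal.rpow_le_rpow hx hp0.le
    rw [inter_comm, ← Measure.restrict_restrict hsm, ← lintegral_indicator hsm]
    refine lintegral_mono_ae ?_
    filter_upwards [minWeakUpperGradient_ae_le hp0 hHm hHdom hHfin, hN0] with x hx hxN
    by_cases hxs : x ∈ s
    · rw [indicator_of_mem hxs]
      refine (ENNReal.rpow_le_rpow hx hp0.le).trans ?_
      by_cases h1 : k < u' x
      · simp [H, hxN, θ, h1, hs x hxs]
      · simp [H, hxN, h1, hp0]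
    · rw [indicator_of_notMem hxs]
      exact zero_le

end

section

/-! ### Densities at codimension one, and nested averages -/

variable {X : Type*} [MetricSpace X] [MeasurableSpace X]

namespace IsDoublingWith

variable {μ : Measure X} {CD : ℝ≥0}

theorem measure_ball_pos (h : IsDoublingWith μ CD) (x : X) {r : ℝ} (hr : 0 < r) :
    0 < μ (ball x r) := by
  simpa [mul_div_cancel₀] using (h x (r / 2) (by positivity)).1

theorem measure_ball_lt_top (h : IsDoublingWith μ CD) (x : X) {r : ℝ} (hr : 0 < r) :
    μ (ball x r) < ∞ := (h x r hr).2.2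

theorem measure_ball_two_mul_le (h : IsDoublingWith μ CD) (x : X) {r : ℝ} (hr : 0 < r) :
    μ (ball x (2 * r)) ≤ CD * μ (ball x r) := (h x r hr).2.1

theorem measure_ball_four_mul_le (h : IsDoublingWith μ CD) (x : X) {r : ℝ} (hr : 0 < r) :
    μ (ball x (4 * r)) ≤ CD ^ 2 * μ (ball x r) := by
  rw [show 4 * r = 2 * (2 * r) by ring, sq, mul_assoc]
  exact (h.measure_ball_two_mul_le x (by positivity)).trans
    (by gcongr; exact h.measure_ball_two_mul_le x hr)

theorem measure_lt_top (h : IsDoublingWith μ CD) {s : Set X} (hs : Bornology.IsBounded s) :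
    μ s < ∞ := by
  rcases s.eq_empty_or_nonempty with rfl | ⟨x, -⟩
  · simp
  · obtain ⟨r, hr, hsub⟩ := hs.subset_ball_lt 0 x
    exact (measure_mono hsub).trans_lt (h.measure_ball_lt_top x hr)

end IsDoublingWith

/-- Vitali covering: disjoint balls of radius s centred in E have enlargements of radius 4s that
cover E. The codimension bound and doubling compare P on each enlargement with ν on the small ball,
and the latter sum to at most ν univ. Positivity of ν on the balls makes the family countable. -/
theorem measure_le_of_forall_measure_ball_le [OpensMeasurableSpace X] {μ ν P : Measure X}
    [IsFiniteMeasure ν] {CD : ℝ≥0} (hμ : IsDoublingWith μ CD) {A κ : ℝ≥0∞} {s : ℝ} (hs : 0 < s)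
    {E : Set X}
    (hP : ∀ y ∈ E, P (ball y (4 * s)) ≤ A * (μ (ball y (4 * s)) / ENNReal.ofReal (4 * s)))
    (hpos : ∀ y ∈ E, 0 < ν (ball y s)) (hκ : ∀ y ∈ E, μ (ball y s) ≤ κ * ν (ball y s)) :
    P E ≤ A * CD ^ 2 * (κ / ENNReal.ofReal s) * ν univ := by
  obtain ⟨F, hFE, hdisj, hcov⟩ := Vitali.exists_disjoint_subfamily_covering_enlargement_ball E
    (fun y => y) (fun _ => s) s (fun _ _ => le_rfl) 4 (by norm_num)
  have hdisj' : Pairwise (Function.onFun Disjoint fun y : F => ball (y : X) s) := fun a b hab =>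
    hdisj a.2 b.2 (fun h => hab (Subtype.ext h))
  have hFc : Countable F := by
    have h := Measure.countable_meas_pos_of_disjoint_iUnion (μ := ν)
      (fun y : F => measurableSet_ball (x := (y : X)) (ε := s)) hdisj'
    have huniv : {y : F | 0 < ν (ball (y : X) s)} = univ :=
      eq_univ_of_forall fun y => hpos y (hFE y.2)
    rw [huniv] at h
    exact countable_univ_iff.1 h
  have hsub : E ⊆ ⋃ y : F, ball (y : X) (4 * s) := fun y hy => by
    obtain ⟨b, hb, hyb⟩ := hcov y hy
    exact mem_iUnion.2 ⟨⟨b, hb⟩, hyb (mem_ball_self hs)⟩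
  have hone : ∀ y : F, P (ball (y : X) (4 * s)) ≤
      A * CD ^ 2 * (κ / ENNReal.ofReal s) * ν (ball (y : X) s) := fun y => by
    refine (hP y (hFE y.2)).trans ?_
    calc A * (μ (ball (y : X) (4 * s)) / ENNReal.ofReal (4 * s))
        ≤ A * ((CD ^ 2 * (κ * ν (ball (y : X) s))) / ENNReal.ofReal s) := by
          gcongr
          · exact (hμ.measure_ball_four_mul_le y hs).trans (by gcongr; exact hκ y (hFE y.2))
          · linarith
      _ = A * CD ^ 2 * (κ / ENNReal.ofReal s) * ν (ball (y : X) s) := by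
          simp only [div_eq_mul_inv]
          ring
  calc P E ≤ ∑' y : F, P (ball (y : X) (4 * s)) := (measure_mono hsub).trans (measure_iUnion_le _)
    _ ≤ ∑' y : F, A * CD ^ 2 * (κ / ENNReal.ofReal s) * ν (ball (y : X) s) :=
      ENNReal.tsum_le_tsum hone
    _ = A * CD ^ 2 * (κ / ENNReal.ofReal s) * ∑' y : F, ν (ball (y : X) s) := ENNReal.tsum_mul_left
    _ ≤ A * CD ^ 2 * (κ / ENNReal.ofReal s) * ν univ := by
      gcongr
      rw [← measure_iUnion hdisj' fun y => measurableSet_ball]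
      exact measure_mono (subset_univ _)

/-- If `P` has codimension at most one with respect to `μ` on `S`, then the `ν`-density at scale
`2⁻ⁱ` is eventually below `τ ^ i` for every `τ > 2`, at `P`-almost every point of `S`. -/
theorem ae_eventually_measure_ball_le [OpensMeasurableSpace X] {μ ν P : Measure X}
    [IsFiniteMeasure ν] {CD A : ℝ≥0} (hμ : IsDoublingWith μ CD) {d : ℝ} (hd : 0 < d)
    {S : Set X} (hS : MeasurableSet S) (hP : ∀ r, 0 < r → r ≤ d → ∀ y ∈ S,
      P (ball y r) ≤ A * (μ (ball y r) / ENNReal.ofReal r)) {τ : ℝ} (hτ : 2 < τ) :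
    ∀ᵐ y ∂(P.restrict S), ∀ᶠ i : ℕ in atTop,
      ν (ball y (4 * (1 / 2) ^ i)) ≤ ENNReal.ofReal (τ ^ i) * μ (ball y (4 * (1 / 2) ^ i)) := by
  rw [ae_restrict_iff' hS]
  have hlim : Tendsto (fun i : ℕ => 4 * (4 * (1 / 2 : ℝ) ^ i)) atTop (𝓝 0) := by
    simpa using ((tendsto_pow_atTop_nhds_zero_of_lt_one (r := (1 / 2 : ℝ)) (by norm_num)
      (by norm_num)).const_mul 4).const_mul 4
  obtain ⟨i₀, hi₀⟩ := eventually_atTop.1 (hlim.eventually_le_const hd)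
  let E : ℕ → X → Prop := fun i y => y ∈ S ∧
    ENNReal.ofReal (τ ^ i) * μ (ball y (4 * (1 / 2) ^ i)) < ν (ball y (4 * (1 / 2) ^ i))
  have hτ0 : 0 < τ := by linarith
  -- The density threshold contributes τ^(-i) and the codimension 2^i: a convergent geometric series
  -- because τ > 2, as Borel-Cantelli requires.
  have hE : ∀ i, P {y | E (i + i₀) y} ≤
      A * CD ^ 2 * ν univ * ENNReal.ofReal (2 / τ) ^ i := by
    intro i
    have hs : (0 : ℝ) < 4 * (1 / 2) ^ (i + i₀) := by positivity
    have hτi : 0 < τ ^ (i + i₀) := by positivity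
    refine (measure_le_of_forall_measure_ball_le (ν := ν) (A := A)
      (κ := (ENNReal.ofReal (τ ^ (i + i₀)))⁻¹)
      hμ hs (fun y hy => hP _ (by positivity) (hi₀ _ (by lia)) y hy.1)
      (fun y hy => pos_of_gt hy.2) fun y hy => ?_).trans ?_
    · rw [← ENNReal.div_eq_inv_mul, ENNReal.le_div_iff_mul_le (by simp [hτi]) (by simp), mul_comm]
      exact hy.2.le
    · rw [mul_right_comm]
      gcongr
      rw [← ENNReal.ofReal_inv_of_pos hτi, ← ENNReal.ofReal_div_of_pos hs,
        ← ENNReal.ofReal_pow (by positivity)]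
      refine ENNReal.ofReal_le_ofReal ?_
      calc (τ ^ (i + i₀))⁻¹ / (4 * (1 / 2) ^ (i + i₀)) = (2 / τ) ^ (i + i₀) / 4 := by
            rw [div_pow, div_pow, one_pow]
            field_simp
        _ ≤ (2 / τ) ^ (i + i₀) := div_le_self (by positivity) (by norm_num)
        _ ≤ (2 / τ) ^ i := pow_le_pow_of_le_one (by positivity)
            (by rw [div_le_one hτ0]; exact hτ.le) (by lia)
  have hsum : ∑' i, P {y | E (i + i₀) y} ≠ ∞ := by
    refine ne_top_of_le_ne_top ?_ (ENNReal.tsum_le_tsum hE)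
    rw [ENNReal.tsum_mul_left]
    refine ENNReal.mul_ne_top (by finiteness) ?_
    have : ENNReal.ofReal (2 / τ) < 1 := by
      rw [ENNReal.ofReal_lt_one, div_lt_one hτ0]
      exact hτ
    rw [ENNReal.tsum_geometric]
    simpa [tsub_eq_zero_iff_le] using this
  have h0 := measure_setOfPred_frequently_eq_zero hsum
  have hae : ∀ᵐ y ∂P, ¬ ∃ᶠ i in atTop, E (i + i₀) y := by
    rw [ae_iff]
    simpa only [not_not] using h0
  filter_upwards [hae] with y hy hyS
  rw [not_frequently] at hy
  rw [← map_add_atTop_eq_nat i₀, eventually_map]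
  filter_upwards [hy] with i hi
  by_contra hlt
  exact hi ⟨hyS, not_le.1 hlt⟩

/-- On D (i + 1) both m i and m (i + 1) approximate u, so they differ by at most C (K + 1) β^i. The
sequence is Cauchy, and its limit is c. -/
theorem exists_tendsto_setIntegral_abs_sub_div {Y : Type*} [MeasurableSpace Y] {μ : Measure Y}
    {D : ℕ → Set Y} {u : Y → ℝ} {m : ℕ → ℝ} {C K β : ℝ} (hC : 0 ≤ C) (hβ : 0 ≤ β) (hβ1 : β < 1)
    (hsub : ∀ i, D (i + 1) ⊆ D i) (hpos : ∀ i, 0 < μ.real (D i))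
    (hK : ∀ i, μ.real (D i) ≤ K * μ.real (D (i + 1))) (hu : ∀ i, IntegrableOn u (D i) μ)
    (hm : ∀ i, ∫ x in D i, |u x - m i| ∂μ ≤ C * β ^ i * μ.real (D i)) :
    ∃ c, Tendsto (fun i => (∫ x in D i, |u x - c| ∂μ) / μ.real (D i)) atTop (𝓝 0) := by
  have hfin : ∀ i, μ (D i) ≠ ∞ := fun i h => by simpa [Measure.real, h] using hpos i
  have hint : ∀ i c, IntegrableOn (fun x => |u x - c|) (D i) μ := fun i c =>
    ((hu i).sub (integrableOn_const (hfin i))).abs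
  have hstep : ∀ i a b, |a - b| * μ.real (D i) ≤
      (∫ x in D i, |u x - a| ∂μ) + ∫ x in D i, |u x - b| ∂μ := by
    intro i a b
    rw [← integral_add (hint i a) (hint i b)]
    calc |a - b| * μ.real (D i) = ∫ _ in D i, |a - b| ∂μ := by simp [mul_comm]
      _ ≤ _ := by
        refine integral_mono (integrableOn_const (hfin i)) ((hint i a).add (hint i b)) fun x => ?_
        calc |a - b| = |(u x - b) - (u x - a)| := by ring_nf
          _ ≤ |u x - b| + |u x - a| := abs_sub _ _
          _ = _ := add_comm _ _
  have hdist : ∀ i, dist (m i) (m (i + 1)) ≤ C * (K + 1) * β ^ i := by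
    intro i
    have h1 := hstep (i + 1) (m i) (m (i + 1))
    have h2 : ∫ x in D (i + 1), |u x - m i| ∂μ ≤ ∫ x in D i, |u x - m i| ∂μ :=
      setIntegral_mono_set (hint i _) (Eventually.of_forall fun x => abs_nonneg _)
        (hsub i).eventuallyLE
    have h3 : C * β ^ i * μ.real (D i) ≤ C * β ^ i * (K * μ.real (D (i + 1))) := by
      gcongr
      exact hK i
    have h4 : C * β ^ (i + 1) * μ.real (D (i + 1)) ≤ C * β ^ i * μ.real (D (i + 1)) := by
      gcongr ?_ * _
      gcongr C * ?_
      exact pow_le_pow_of_le_one hβ hβ1.le (by lia)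
    rw [Real.dist_eq]
    refine le_of_mul_le_mul_right ?_ (hpos (i + 1))
    linarith [hm i, hm (i + 1)]
  obtain ⟨c, hc⟩ := cauchySeq_tendsto_of_complete (cauchySeq_of_le_geometric β _ hβ1 hdist)
  refine ⟨c, squeeze_zero (g := fun i => C * β ^ i + |m i - c|) (fun i => ?_) (fun i => ?_) ?_⟩
  · exact div_nonneg (integral_nonneg fun x => abs_nonneg _) measureReal_nonneg
  · rw [div_le_iff₀ (hpos i), add_mul]
    calc ∫ x in D i, |u x - c| ∂μ ≤ ∫ x in D i, (|u x - m i| + |m i - c|) ∂μ := by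
          refine integral_mono (hint i c) ((hint i _).add (integrableOn_const (hfin i))) fun x => ?_
          exact abs_sub_le _ _ _
      _ = (∫ x in D i, |u x - m i| ∂μ) + |m i - c| * μ.real (D i) := by
          rw [integral_add (hint i _) (integrableOn_const (hfin i))]
          simp [mul_comm]
      _ ≤ _ := by gcongr; exact hm i
  · have h1 := (tendsto_pow_atTop_nhds_zero_of_lt_one hβ hβ1).const_mul C
    have h2 := (hc.sub_const c).abs
    simpa using h1.add h2

end

section

/-! ### Traces -/

variable {X : Type*} [MetricSpace X] [MeasurableSpace X]

theorem setIntegral_abs_le_of_setLAverage_le {Y : Type*} [MeasurableSpace Y] {μ : Measure Y}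
    {D : Set Y} {w : Y → ℝ} {ε : ℝ} (hε : 0 ≤ ε) (h0 : μ D ≠ 0) (hfin : μ D ≠ ∞)
    (hw : IntegrableOn w D μ) (h : ⨍⁻ y in D, ENNReal.ofReal |w y| ∂μ ≤ ENNReal.ofReal ε) :
    ∫ y in D, |w y| ∂μ ≤ ε * μ.real D := by
  rw [setLAverage_eq, ENNReal.div_le_iff h0 hfin] at h
  rw [integral_eq_lintegral_of_nonneg_ae (Eventually.of_forall fun y => abs_nonneg _) hw.1.norm]
  refine (ENNReal.toReal_mono (by finiteness) h).trans ?_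
  rw [ENNReal.toReal_mul, ENNReal.toReal_ofReal hε, Measure.real]

theorem exists_hasTraceAt_of_eventually_measure_ball_le [BorelSpace X] {μ : Measure X} {p : ℝ}
    (hp : 1 < p) {CD CP A : ℝ≥0} (hμ : IsDoublingWith μ CD) {Ω : Set X}
    {d : ℝ} (hd : 0 < d)
    (hdens : ∀ r, 0 < r → r ≤ d → ∀ z ∈ Ω, μ (ball z r) ≤ A * μ (ball z r ∩ Ω))
    (hpoin : SupportsPoincareOn μ p Ω CP 1) {u : X → ℝ} {g : X → ℝ≥0∞} (hu : IntegrableOn u Ω μ)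
    (hg : IsUpperGradientOn Ω u g) {T : ℝ} (hT0 : 0 < T) (hT2 : T < 2) {y : X} (hy : y ∈ closure Ω)
    (hgood : ∀ᶠ i : ℕ in atTop, ∫⁻ x in ball y (4 * (1 / 2) ^ i) ∩ Ω, g x ^ p ∂μ ≤
      ENNReal.ofReal ((T ^ p) ^ i) * μ (ball y (4 * (1 / 2) ^ i))) :
    ∃ c, HasTraceAt μ Ω u y c := by
  have hp0 : 0 < p := by linarith
  have hlim : Tendsto (fun i : ℕ => 3 * (1 / 2 : ℝ) ^ i) atTop (𝓝 0) := by
    simpa using (tendsto_pow_atTop_nhds_zero_of_lt_one (r := (1 / 2 : ℝ)) (by norm_num)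
      (by norm_num)).const_mul 3
  obtain ⟨i₀, hi₀⟩ := eventually_atTop.1 (hgood.and (hlim.eventually_le_const hd))
  have hr : ∀ i : ℕ, (0 : ℝ) < (1 / 2) ^ i := fun i => by positivity
  have hrs : ∀ i : ℕ, (1 / 2 : ℝ) ^ (i + 1) = (1 / 2) ^ i / 2 := fun i => by rw [pow_succ]; ring
  have hz : ∀ i : ℕ, ∃ z ∈ Ω, dist y z < (1 / 2) ^ i := fun i => Metric.mem_closure_iff.1 hy _ (hr i)
  choose z hzΩ hzd using hz
  -- The Poincaré and density hypotheses concern balls centred in Ω, so y is replaced by nearby z i.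
  -- Radius 3 * 2^(-i) places the ball between those of radii 2 * 2^(-i) and 4 * 2^(-i) about y,
  -- which makes the D i nested.
  let D : ℕ → Set X := fun i => ball (z (i + i₀)) (3 * (1 / 2) ^ (i + i₀)) ∩ Ω
  let m : ℕ → ℝ := fun i => ⨍ w in D i, u w ∂μ
  have hdens' : ∀ i, μ (ball (z (i + i₀)) (3 * (1 / 2) ^ (i + i₀))) ≤ A * μ (D i) := fun i =>
    hdens _ (by positivity) (hi₀ _ (by lia)).2 _ (hzΩ _)
  have hD0 : ∀ i, μ (D i) ≠ 0 := fun i h0 => by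
    have h1 := hdens' i
    rw [h0, mul_zero] at h1
    exact (hμ.measure_ball_pos _ (by positivity)).not_ge h1
  have hDtop : ∀ i, μ (D i) ≠ ∞ := fun i =>
    ((measure_mono inter_subset_left).trans_lt
      (hμ.measure_ball_lt_top _ (by positivity))).ne
  have hpos : ∀ i, 0 < μ.real (D i) := fun i => ENNReal.toReal_pos (hD0 i) (hDtop i)
  have hball : ∀ i, ball (z i) (3 * (1 / 2) ^ i) ⊆ ball y (4 * (1 / 2) ^ i) := fun i =>
    ball_subset_ball' (by have := hzd i; rw [dist_comm] at this; linarith)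
  have hball' : ∀ (i : ℕ) (r : ℝ), r ≤ 2 * (1 / 2) ^ i → ball y r ⊆ ball (z i) (3 * (1 / 2) ^ i) :=
    fun i r hri => ball_subset_ball' (by have := hzd i; linarith)
  have hsub : ∀ i, D (i + 1) ⊆ D i := fun i => by
    refine inter_subset_inter_left _ ?_
    have h1 := hball (i + 1 + i₀)
    refine h1.trans (hball' (i + i₀) _ ?_)
    rw [show i + 1 + i₀ = i + i₀ + 1 by ring, hrs]
    linarith
  have hKE : ∀ i, μ (D i) ≤ (CD ^ 2 * A : ℝ≥0) * μ (D (i + 1)) := fun i => by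
    have h1 : D i ⊆ ball (z (i + 1 + i₀)) (4 * (3 * (1 / 2) ^ (i + 1 + i₀))) := by
      refine inter_subset_left.trans (ball_subset_ball' ?_)
      have h2 := hzd (i + 1 + i₀)
      have h3 := hzd (i + i₀)
      have h4 := dist_triangle_left (z (i + i₀)) (z (i + 1 + i₀)) y
      have h5 := hr (i + i₀)
      rw [show i + 1 + i₀ = i + i₀ + 1 by ring, hrs] at h2 ⊢
      rw [show i + 1 + i₀ = i + i₀ + 1 by ring] at h4
      linarith
    calc μ (D i) ≤ CD ^ 2 * μ (ball (z (i + 1 + i₀)) (3 * (1 / 2) ^ (i + 1 + i₀))) :=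
          (measure_mono h1).trans (hμ.measure_ball_four_mul_le _ (by positivity))
      _ ≤ CD ^ 2 * (A * μ (D (i + 1))) := by gcongr; exact hdens' (i + 1)
      _ = _ := by push_cast; ring
  have hK : ∀ i, μ.real (D i) ≤ (CD ^ 2 * A : ℝ≥0) * μ.real (D (i + 1)) := fun i => by
    have h1 := ENNReal.toReal_mono (ENNReal.mul_ne_top ENNReal.coe_ne_top (hDtop _)) (hKE i)
    rwa [ENNReal.toReal_mul, ENNReal.coe_toReal] at h1
  have hint : ∀ i c, IntegrableOn (fun x => u x - c) (D i) μ := fun i c =>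
    (hu.mono_set inter_subset_right).sub (integrableOn_const (hDtop i))
  let C : ℝ := CP * 3 * (1 / 2) ^ i₀ * ((A * CD : ℝ≥0) : ℝ) ^ (1 / p) * T ^ i₀
  have hm : ∀ i, ∫ x in D i, |u x - m i| ∂μ ≤ C * (T / 2) ^ i * μ.real (D i) := fun i => by
    refine setIntegral_abs_le_of_setLAverage_le (by positivity) (hD0 i) (hDtop i) (hint i _) ?_
    refine (hpoin.2 (z (i + i₀)) (hzΩ _) (3 * (1 / 2) ^ (i + i₀)) (by positivity) u g
      (fun s hs _ => hu.mono_set hs) hg).trans ?_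
    rw [one_mul]
    have havg : ⨍⁻ x in D i, g x ^ p ∂μ ≤ (A * CD : ℝ≥0) * ENNReal.ofReal ((T ^ p) ^ (i + i₀)) := by
      rw [setLAverage_eq, ENNReal.div_le_iff (hD0 i) (hDtop i)]
      calc ∫⁻ x in D i, g x ^ p ∂μ
          ≤ ∫⁻ x in ball y (4 * (1 / 2) ^ (i + i₀)) ∩ Ω, g x ^ p ∂μ :=
            lintegral_mono_set (inter_subset_inter_left _ (hball _))
        _ ≤ ENNReal.ofReal ((T ^ p) ^ (i + i₀)) * μ (ball y (4 * (1 / 2) ^ (i + i₀))) :=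
            (hi₀ (i + i₀) (by lia)).1
        _ ≤ ENNReal.ofReal ((T ^ p) ^ (i + i₀)) * (CD * (A * μ (D i))) := by
            gcongr
            refine le_trans (measure_mono (ball_subset_ball' ?_)) ((hμ.measure_ball_two_mul_le
              (z (i + i₀)) (r := 3 * (1 / 2) ^ (i + i₀)) (by positivity)).trans
              (by gcongr; exact hdens' i))
            have := hzd (i + i₀)
            linarith [hr (i + i₀)]
        _ = _ := by push_cast; ring
    calc CP * ENNReal.ofReal (3 * (1 / 2) ^ (i + i₀)) * (⨍⁻ x in D i, g x ^ p ∂μ) ^ (1 / p)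
        ≤ CP * ENNReal.ofReal (3 * (1 / 2) ^ (i + i₀)) *
          ((A * CD : ℝ≥0) * ENNReal.ofReal ((T ^ p) ^ (i + i₀))) ^ (1 / p) := by gcongr
      _ = ENNReal.ofReal (C * (T / 2) ^ i) := by
        rw [← ENNReal.ofReal_coe_nnreal, ← ENNReal.ofReal_coe_nnreal,
          ← ENNReal.ofReal_mul (by positivity), ← ENNReal.ofReal_mul (by positivity),
          ENNReal.ofReal_rpow_of_nonneg (by positivity) (by positivity),
          ← ENNReal.ofReal_mul (by positivity), Real.mul_rpow (by positivity) (by positivity)]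
        congr 1
        have h1 : ((T ^ p) ^ (i + i₀)) ^ (1 / p) = T ^ (i + i₀) := by
          rw [← Real.rpow_natCast (T ^ p), ← Real.rpow_mul (by positivity),
            ← Real.rpow_mul hT0.le, ← Real.rpow_natCast T]
          congr 1
          field_simp
        have h2 : (T / 2) ^ i = T ^ i * (1 / 2) ^ i := by rw [← mul_pow, mul_one_div]
        rw [h1, h2, pow_add, pow_add]
        ring
  obtain ⟨c, hc⟩ := exists_tendsto_setIntegral_abs_sub_div (by positivity) (by positivity)
    (show T / 2 < 1 by linarith) hsub hpos hK (fun i => hu.mono_set inter_subset_right) hm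
  refine ⟨c, ?_⟩
  let K : ℝ := (CD ^ 2 * A : ℝ≥0)
  -- Three generations are lost in passing to arbitrary radii: if 2^(-n-1) < r ≤ 2^(-n) with n = i +
  -- i₀, then D (i + 3) ⊆ B(y,r) ∩ Ω ⊆ D i, since 4 * 2^(-n-3) = 2^(-n-1).
  have hK3 : ∀ i, μ.real (D i) ≤ K ^ 3 * μ.real (D (i + 3)) := fun i => by
    have hK0 : 0 ≤ K := NNReal.coe_nonneg _
    calc μ.real (D i) ≤ K * μ.real (D (i + 1)) := hK i
      _ ≤ K * (K * μ.real (D (i + 2))) := by gcongr; exact hK (i + 1)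
      _ ≤ K * (K * (K * μ.real (D (i + 3)))) := by gcongr; exact hK (i + 2)
      _ = _ := by ring
  have hcK := hc.const_mul (K ^ 3)
  rw [mul_zero] at hcK
  rw [HasTraceAt, Metric.tendsto_nhdsWithin_nhds]
  intro ε hε
  obtain ⟨j, hj⟩ := eventually_atTop.1 (hcK.eventually_lt_const hε)
  refine ⟨(1 / 2) ^ (j + i₀), hr _, fun {r} hr0 hrd => ?_⟩
  rw [mem_Ioi] at hr0
  rw [Real.dist_eq, sub_zero, abs_of_pos hr0] at hrd
  obtain ⟨n, hn1, hn2⟩ := exists_nat_pow_near_of_lt_one hr0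
    (hrd.le.trans (pow_le_one₀ (by norm_num) (by norm_num)))
    (show (0 : ℝ) < 1 / 2 by norm_num) (by norm_num)
  have hjn : j + i₀ ≤ n := by
    by_contra hlt
    have : (1 / 2 : ℝ) ^ (j + i₀) ≤ (1 / 2) ^ (n + 1) :=
      pow_le_pow_of_le_one (by norm_num) (by norm_num) (by lia)
    linarith
  obtain ⟨i, rfl⟩ : ∃ i, n = i + i₀ := ⟨n - i₀, by lia⟩
  have hBD : ball y r ∩ Ω ⊆ D i :=
    inter_subset_inter_left _ (hball' _ _ (by linarith [hr (i + i₀)]))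
  have hDB : D (i + 3) ⊆ ball y r ∩ Ω := by
    refine inter_subset_inter_left _ ((hball _).trans (ball_subset_ball ?_))
    rw [show i + 3 + i₀ = i + i₀ + 1 + 1 + 1 by ring, hrs, hrs]
    linarith
  have hBtop : μ (ball y r ∩ Ω) ≠ ∞ := ((measure_mono hBD).trans_lt (hDtop i).lt_top).ne
  have hBge : μ.real (D (i + 3)) ≤ μ.real (ball y r ∩ Ω) := measureReal_mono hDB hBtop
  have hBpos : 0 < μ.real (ball y r ∩ Ω) := (hpos _).trans_le hBge
  have hI : ∫ x in ball y r ∩ Ω, |u x - c| ∂μ ≤ ∫ x in D i, |u x - c| ∂μ :=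
    setIntegral_mono_set (hint i c).abs (Eventually.of_forall fun x => abs_nonneg _)
      hBD.eventuallyLE
  have hI0 : 0 ≤ ∫ x in ball y r ∩ Ω, |u x - c| ∂μ := integral_nonneg fun x => abs_nonneg _
  rw [Real.dist_eq, sub_zero, setAverage_eq, smul_eq_mul,
    abs_of_nonneg (mul_nonneg (inv_nonneg.2 hBpos.le) hI0)]
  refine lt_of_le_of_lt ?_ (hj i (by lia))
  rw [← div_eq_inv_mul, div_le_iff₀ hBpos]
  calc ∫ x in ball y r ∩ Ω, |u x - c| ∂μ
      ≤ (∫ x in D i, |u x - c| ∂μ) / μ.real (D i) * μ.real (D i) := by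
        rw [div_mul_cancel₀ _ (hpos i).ne']
        exact hI
    _ ≤ (∫ x in D i, |u x - c| ∂μ) / μ.real (D i) * (K ^ 3 * μ.real (ball y r ∩ Ω)) := by
        have : 0 ≤ ∫ x in D i, |u x - c| ∂μ := integral_nonneg fun x => abs_nonneg _
        have hK0 : 0 ≤ K := NNReal.coe_nonneg _
        gcongr
        exact (hK3 i).trans (by gcongr)
    _ = _ := by ring

theorem MemNewtonian.integrableOn {μ : Measure X} {p : ℝ} (hp : 1 ≤ p) {Ω : Set X}
    (hμΩ : μ Ω ≠ ∞) {u : X → ℝ} (hu : MemNewtonian μ p Ω u) : IntegrableOn u Ω μ := by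
  have : IsFiniteMeasure (μ.restrict Ω) := ⟨by simpa [lt_top_iff_ne_top] using hμΩ⟩
  exact hu.1.integrable (by simpa using hp)

/-- A Newtonian function has a trace almost everywhere with respect to a measure of codimension
at most one on the boundary. -/
theorem MemNewtonian.ae_exists_hasTraceAt [BorelSpace X] {μ P : Measure X} {p : ℝ}
    (hp : 1 < p) {CD CP A : ℝ≥0} (hμ : IsDoublingWith μ CD) {Ω : Set X}
    (hμΩ : μ Ω ≠ ∞) {d : ℝ} (hd : 0 < d)
    (hdens : ∀ r, 0 < r → r ≤ d → ∀ z ∈ Ω, μ (ball z r) ≤ A * μ (ball z r ∩ Ω))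
    (hP : ∀ r, 0 < r → r ≤ d → ∀ y ∈ frontier Ω,
      P (ball y r) ≤ A * (μ (ball y r) / ENNReal.ofReal r))
    (hpoin : SupportsPoincareOn μ p Ω CP 1) {u : X → ℝ} (hu : MemNewtonian μ p Ω u) :
    ∀ᵐ y ∂(P.restrict (frontier Ω)), ∃ c, HasTraceAt μ Ω u y c := by
  have hp0 : 0 < p := by linarith
  obtain ⟨g, hg, hgfin⟩ := hu.2
  let ν : Measure X := (μ.restrict Ω).withDensity fun x => g x ^ p
  have hνfin : IsFiniteMeasure ν := isFiniteMeasure_withDensity hgfin.ne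
  have hpinv : 1 / p < 1 := by rwa [div_lt_one hp0]
  -- The exponent lies strictly between 1/p and 1, which is possible because p > 1: T^p > 2 serves
  -- Borel-Cantelli and T < 2 the decay of oscillations.
  let T : ℝ := 2 ^ ((1 / p + 1) / 2)
  have hT0 : 0 < T := by positivity
  have hT2 : T < 2 := by
    calc T < (2 : ℝ) ^ (1 : ℝ) := Real.rpow_lt_rpow_of_exponent_lt (by norm_num) (by linarith)
      _ = 2 := Real.rpow_one 2
  have hTp : 2 < T ^ p := by
    rw [← Real.rpow_mul (by norm_num)]
    calc (2 : ℝ) = 2 ^ (1 : ℝ) := (Real.rpow_one 2).symm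
      _ < _ := by
        refine Real.rpow_lt_rpow_of_exponent_lt (by norm_num) ?_
        rw [div_mul_eq_mul_div, add_mul, one_mul, one_div, inv_mul_cancel₀ hp0.ne']
        linarith
  have hmeas : MeasurableSet (frontier Ω) := isClosed_frontier.measurableSet
  filter_upwards [ae_eventually_measure_ball_le (ν := ν) hμ hd hmeas hP hTp,
    ae_restrict_mem hmeas] with y hy hyΩ
  refine exists_hasTraceAt_of_eventually_measure_ball_le hp hμ hd hdens hpoin
    (hu.integrableOn hp.le hμΩ) hg hT0 hT2 (frontier_subset_closure hyΩ) ?_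
  filter_upwards [hy] with i hi
  rwa [withDensity_apply _ measurableSet_ball, Measure.restrict_restrict measurableSet_ball] at hi

/-! ### Uniqueness, truncation and measurability of traces -/

theorem abs_average_sub_le {Y : Type*} [MeasurableSpace Y] {μ : Measure Y} [IsFiniteMeasure μ]
    [NeZero μ] {u : Y → ℝ} (hu : Integrable u μ) (c : ℝ) :
    |(⨍ y, u y ∂μ) - c| ≤ ⨍ y, |u y - c| ∂μ := by
  have h1 : (⨍ y, u y ∂μ) - c = ⨍ y, (u y - c) ∂μ := by
    simp only [average]
    rw [integral_sub hu.to_average (integrable_const c)]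
    simp
  rw [h1]
  simp only [average]
  exact abs_integral_le_integral_abs

theorem measure_ball_inter_pos {μ : Measure X} {CD : ℝ≥0}
    (hμ : IsDoublingWith μ CD) {Ω : Set X} (hΩ : IsOpen Ω) {y : X} (hy : y ∈ closure Ω) {r : ℝ}
    (hr : 0 < r) : 0 < μ (ball y r ∩ Ω) := by
  obtain ⟨z, hz, hzd⟩ := Metric.mem_closure_iff.1 hy r hr
  obtain ⟨ε, hε, hsub⟩ := Metric.isOpen_iff.1 (isOpen_ball.inter hΩ) z
    ⟨by rwa [mem_ball, dist_comm], hz⟩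
  exact (hμ.measure_ball_pos z hε).trans_le (measure_mono hsub)

theorem HasTraceAt.tendsto_average {μ : Measure X} {Ω : Set X} {u : X → ℝ} {y : X} {c : ℝ}
    (h : HasTraceAt μ Ω u y c) (hu : IntegrableOn u Ω μ) (hμΩ : μ Ω ≠ ∞)
    (hpos : ∀ r > 0, 0 < μ (ball y r ∩ Ω)) :
    Tendsto (fun r => ⨍ x in ball y r ∩ Ω, u x ∂μ) (𝓝[>] 0) (𝓝 c) := by
  rw [tendsto_iff_dist_tendsto_zero]
  refine squeeze_zero' (Eventually.of_forall fun r => dist_nonneg) ?_ h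
  filter_upwards [self_mem_nhdsWithin] with r hr
  have hfin : μ (ball y r ∩ Ω) < ∞ := (measure_mono inter_subset_right).trans_lt hμΩ.lt_top
  have : IsFiniteMeasure (μ.restrict (ball y r ∩ Ω)) := ⟨by simpa using hfin⟩
  have : NeZero (μ.restrict (ball y r ∩ Ω)) :=
    ⟨fun h0 => (hpos r hr).ne' (Measure.restrict_eq_zero.1 h0)⟩
  exact abs_average_sub_le (hu.mono_set inter_subset_right) c

theorem HasTraceAt.traceFn_eq {μ : Measure X} {Ω : Set X} {u : X → ℝ} {y : X} {c : ℝ}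
    (h : HasTraceAt μ Ω u y c) (hu : IntegrableOn u Ω μ) (hμΩ : μ Ω ≠ ∞)
    (hpos : ∀ r > 0, 0 < μ (ball y r ∩ Ω)) : traceFn μ Ω u y = c := by
  have hex : ∃ c, HasTraceAt μ Ω u y c := ⟨c, h⟩
  rw [traceFn, dif_pos hex]
  exact tendsto_nhds_unique (hex.choose_spec.tendsto_average hu hμΩ hpos)
    (h.tendsto_average hu hμΩ hpos)

theorem HasTraceAt.of_abs_sub_le {μ : Measure X} {Ω : Set X} (hΩ : MeasurableSet Ω)
    [OpensMeasurableSpace X] {u v : X → ℝ} {y : X}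
    {c c' a b : ℝ} (h : HasTraceAt μ Ω u y c) (hu : IntegrableOn u Ω μ) (hμΩ : μ Ω ≠ ∞)
    (hb : 0 ≤ b) (hle : ∀ z ∈ Ω, |v z - c'| ≤ a * |u z - c| + b * dist z y) :
    HasTraceAt μ Ω v y c' := by
  have hlim : Tendsto (fun r => a * (⨍ x in ball y r ∩ Ω, |u x - c| ∂μ) + b * r) (𝓝[>] 0) (𝓝 0) := by
    have h1 : Tendsto (fun r : ℝ => b * r) (𝓝[>] 0) (𝓝 (b * 0)) :=
      (tendsto_id.const_mul b).mono_left nhdsWithin_le_nhds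
    simpa using (h.const_mul a).add h1
  refine squeeze_zero' (Eventually.of_forall fun r => ?_) ?_ hlim
  · rw [setAverage_eq]
    exact mul_nonneg (inv_nonneg.2 measureReal_nonneg) (integral_nonneg fun x => abs_nonneg _)
  · filter_upwards [self_mem_nhdsWithin] with r hr
    have hr0 : (0 : ℝ) < r := hr
    have hfin : μ (ball y r ∩ Ω) < ∞ := (measure_mono inter_subset_right).trans_lt hμΩ.lt_top
    have hi : IntegrableOn (fun x => |u x - c|) (ball y r ∩ Ω) μ :=
      ((hu.mono_set inter_subset_right).sub (integrableOn_const hfin.ne)).abs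
    have hconst : IntegrableOn (fun _ : X => b * r) (ball y r ∩ Ω) μ := integrableOn_const hfin.ne
    have hI : ∫ x in ball y r ∩ Ω, |v x - c'| ∂μ ≤
        a * (∫ x in ball y r ∩ Ω, |u x - c| ∂μ) + b * r * μ.real (ball y r ∩ Ω) := by
      calc ∫ x in ball y r ∩ Ω, |v x - c'| ∂μ
          ≤ ∫ x in ball y r ∩ Ω, (a * |u x - c| + b * r) ∂μ := by
            refine integral_mono_of_nonneg (Eventually.of_forall fun x => abs_nonneg _)
              ((hi.const_mul a).add hconst) ?_
            filter_upwards [ae_restrict_mem (measurableSet_ball.inter hΩ)] with x hx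
            refine (hle x hx.2).trans ?_
            have : dist x y ≤ r := (mem_ball.1 hx.1).le
            gcongr
        _ = _ := by
            rw [integral_add (hi.const_mul a) hconst, integral_const_mul]
            simp [mul_comm]
    rw [setAverage_eq, setAverage_eq, smul_eq_mul, smul_eq_mul]
    refine (mul_le_mul_of_nonneg_left hI (inv_nonneg.2 measureReal_nonneg)).trans ?_
    rw [mul_add, mul_left_comm]
    refine add_le_add_right ?_ _
    calc (μ.real (ball y r ∩ Ω))⁻¹ * (b * r * μ.real (ball y r ∩ Ω))
        = b * r * ((μ.real (ball y r ∩ Ω))⁻¹ * μ.real (ball y r ∩ Ω)) := by ring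
      _ ≤ b * r := mul_le_of_le_one_right (by positivity) inv_mul_le_one

theorem HasTraceAt.sub_cutoff [OpensMeasurableSpace X] {μ : Measure X} {Ω : Set X}
    (hΩ : MeasurableSet Ω) {u ψ : X → ℝ}
    {y : X} {c : ℝ} (h : HasTraceAt μ Ω u y c) (hu : IntegrableOn u Ω μ) (hμΩ : μ Ω ≠ ∞)
    {p : ℝ} (hp : 1 ≤ p) (k : ℝ) {K : ℝ≥0} (hψ : LipschitzWith K ψ)
    (hψI : ∀ x, ψ x ∈ Icc (0 : ℝ) 1) :
    HasTraceAt μ Ω (fun x => u x - ψ x ^ p * max (u x - k) 0) y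
      (c - ψ y ^ p * max (c - k) 0) := by
  have hm : 0 ≤ max (c - k) 0 := le_max_right _ _
  -- One unit of a comes from u and one from its truncation; b is the Lipschitz constant of ψ^p
  -- times the fixed number (c-k)_+.
  refine h.of_abs_sub_le hΩ hu hμΩ (a := 2) (b := p * K * max (c - k) 0) (by positivity)
    fun z _ => ?_
  have h0 : 0 ≤ ψ z ^ p := Real.rpow_nonneg (hψI z).1 _
  have h1 : ψ z ^ p ≤ 1 := Real.rpow_le_one (hψI z).1 (hψI z).2 (by linarith)
  have h2 : |ψ z ^ p - ψ y ^ p| ≤ p * (K * dist z y) :=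
    (abs_rpow_sub_rpow_le_of_mem_Icc hp (hψI z) (hψI y)).trans (by
      gcongr
      exact hψ.dist_le_mul z y)
  have h3 := abs_max_sub_max_le_abs_sub (u z) c k
  calc |u z - ψ z ^ p * max (u z - k) 0 - (c - ψ y ^ p * max (c - k) 0)|
      = |(u z - c) - ψ z ^ p * (max (u z - k) 0 - max (c - k) 0)
          - (ψ z ^ p - ψ y ^ p) * max (c - k) 0| := by ring_nf
    _ ≤ |u z - c| + |ψ z ^ p * (max (u z - k) 0 - max (c - k) 0)|
          + |(ψ z ^ p - ψ y ^ p) * max (c - k) 0| :=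
        (abs_sub _ _).trans (by gcongr; exact abs_sub _ _)
    _ ≤ |u z - c| + 1 * |u z - c| + p * (K * dist z y) * max (c - k) 0 := by
        rw [abs_mul, abs_mul, abs_of_nonneg h0, abs_of_nonneg hm]
        gcongr
    _ = _ := by ring

/-- An open ball is the increasing union of smaller concentric balls, each contained in every ball
of radius r with nearby centre; hence lower semicontinuity. -/
theorem measurable_measure_ball [OpensMeasurableSpace X] (ν : Measure X) (r : ℝ) :
    Measurable fun y => ν (ball y r) := by
  refine LowerSemicontinuous.measurable fun y c hc => ?_
  have hU : ball y r = ⋃ n : ℕ, ball y (r - 1 / ((n : ℝ) + 1)) := by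
    ext z
    simp only [mem_iUnion, mem_ball]
    constructor
    · intro hz
      obtain ⟨n, hn⟩ := exists_nat_one_div_lt (sub_pos.2 hz)
      exact ⟨n, by linarith⟩
    · rintro ⟨n, hn⟩
      have : (0 : ℝ) < 1 / ((n : ℝ) + 1) := by positivity
      linarith
  have hmono : Monotone fun n : ℕ => ball y (r - 1 / ((n : ℝ) + 1)) := fun a b hab =>
    ball_subset_ball (sub_le_sub_left (Nat.one_div_le_one_div hab) r)
  change c < ν (ball y r) at hc
  rw [hU, hmono.measure_iUnion, lt_iSup_iff] at hc
  obtain ⟨n, hn⟩ := hc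
  filter_upwards [ball_mem_nhds y (show (0 : ℝ) < 1 / ((n : ℝ) + 1) by positivity)] with z hz
  refine hn.trans_le (measure_mono (ball_subset_ball' ?_))
  rw [mem_ball, dist_comm] at hz
  linarith

theorem measurable_setIntegral_ball [OpensMeasurableSpace X] {ν : Measure X} {u : X → ℝ}
    (hu : Integrable u ν) (r : ℝ) : Measurable fun y => ∫ x in ball y r, u x ∂ν := by
  have h : ∀ y, ∫ x in ball y r, u x ∂ν =
      ((ν.withDensity fun x => ENNReal.ofReal (u x)) (ball y r)).toReal -
      ((ν.withDensity fun x => ENNReal.ofReal (-u x)) (ball y r)).toReal := fun y => by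
    rw [withDensity_apply _ measurableSet_ball, withDensity_apply _ measurableSet_ball]
    exact integral_eq_lintegral_pos_part_sub_lintegral_neg_part hu.integrableOn
  simp_rw [h]
  exact (measurable_measure_ball _ r).ennreal_toReal.sub
    (measurable_measure_ball _ r).ennreal_toReal

theorem aestronglyMeasurable_traceFn [OpensMeasurableSpace X] {μ P : Measure X} {Ω : Set X}
    {u : X → ℝ} (hu : IntegrableOn u Ω μ) (hμΩ : μ Ω ≠ ∞)
    (hpos : ∀ᵐ y ∂P, ∀ r > 0, 0 < μ (ball y r ∩ Ω))
    (hex : ∀ᵐ y ∂P, ∃ c, HasTraceAt μ Ω u y c) : AEStronglyMeasurable (traceFn μ Ω u) P := by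
  refine (aemeasurable_of_tendsto_metrizable_ae atTop
    (f := fun (n : ℕ) y => ⨍ x in ball y (1 / ((n : ℝ) + 1)) ∩ Ω, u x ∂μ) (fun n => ?_)
    ?_).aestronglyMeasurable
  · simp_rw [setAverage_eq, smul_eq_mul, Measure.real, ← Measure.restrict_apply measurableSet_ball,
      ← Measure.restrict_restrict measurableSet_ball]
    exact (((measurable_measure_ball _ _).ennreal_toReal.inv).mul
      (measurable_setIntegral_ball hu _)).aemeasurable
  · filter_upwards [hpos, hex] with y hy hc
    obtain ⟨c, hc⟩ := hc
    rw [hc.traceFn_eq hu hμΩ hy]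
    refine (hc.tendsto_average hu hμΩ hy).comp ?_
    refine tendsto_nhdsWithin_iff.2 ⟨tendsto_one_div_add_atTop_nhds_zero_nat,
      Eventually.of_forall fun n => ?_⟩
    rw [mem_Ioi]
    positivity

end

/-! ### The Caccioppoli inequality -/


/-- The function b may fail to be integrable. As J is integrable, a then fails as well, and both
integrals have the default value 0, so the comparison survives. -/
theorem integral_le_integral_add_toReal_of_ae_eq_sub {Y : Type*} [MeasurableSpace Y]
    {ν : Measure Y} {a b J : Y → ℝ} (hab : a =ᵐ[ν] fun y => b y - J y)
    (hJ : AEStronglyMeasurable J ν) {D : ℝ≥0∞} (hD : D ≠ ∞) (hJD : ∫⁻ y, ‖J y‖ₑ ∂ν ≤ D) :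
    ∫ y, a y ∂ν ≤ ∫ y, b y ∂ν + D.toReal := by
  have hJint : Integrable J ν := ⟨hJ, hJD.trans_lt hD.lt_top⟩
  by_cases hb : Integrable b ν
  · rw [integral_congr_ae hab, integral_sub hb hJint]
    have h1 : ‖∫ y, J y ∂ν‖ ≤ D.toReal :=
      (norm_integral_le_lintegral_norm _).trans (ENNReal.toReal_mono hD (by
        simpa only [ofReal_norm] using hJD))
    have h2 := neg_le_of_abs_le h1
    linarith
  · have ha : ¬ Integrable a ν := fun ha => hb (by
      refine (ha.add hJint).congr ?_
      filter_upwards [hab] with y hy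
      simp [hy])
    rw [integral_undef ha, integral_undef hb, zero_add]
    exact ENNReal.toReal_nonneg

theorem exists_lipschitz_cutoff {Y : Type*} [MetricSpace Y] (x : Y) {r R : ℝ} (hrR : r < R) :
    ∃ ψ : Y → ℝ, LipschitzWith (R - r)⁻¹.toNNReal ψ ∧ (∀ z, ψ z ∈ Icc (0 : ℝ) 1) ∧
      (∀ z ∈ ball x r, ψ z = 1) ∧ ∀ z ∉ ball x R, ψ z = 0 := by
  have hpos : 0 < R - r := sub_pos.2 hrR
  refine ⟨fun z => max (min ((R - r)⁻¹ * (R - dist z x)) 1) 0, ?_, fun z => ⟨le_max_right _ _,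
    max_le (min_le_right _ _) zero_le_one⟩, fun z hz => ?_, fun z hz => ?_⟩
  · refine LipschitzWith.max_const (LipschitzWith.min_const ?_ 1) 0
    refine LipschitzWith.of_dist_le_mul fun a b => ?_
    rw [Real.coe_toNNReal _ (inv_nonneg.2 hpos.le), Real.dist_eq, ← mul_sub, abs_mul,
      abs_of_pos (inv_pos.2 hpos)]
    gcongr
    rw [show R - dist a x - (R - dist b x) = dist b x - dist a x by ring, dist_comm a b]
    exact abs_dist_sub_le _ _ _
  · have : 1 ≤ (R - r)⁻¹ * (R - dist z x) := by
      rw [← div_eq_inv_mul, one_le_div hpos]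
      linarith [mem_ball.1 hz]
    simp only [min_eq_right this, max_eq_left zero_le_one]
  · have : (R - r)⁻¹ * (R - dist z x) ≤ 0 :=
      mul_nonpos_of_nonneg_of_nonpos (inv_nonneg.2 hpos.le)
        (by linarith [not_lt.1 (fun h => hz (mem_ball.2 h))])
    exact max_eq_right ((min_le_left _ _).trans this)

theorem theorem5p2 (p : ℝ) (hp : 1 < p) (CD CX CΩ : ℝ≥0) (lam : ℝ) :
    ∃ C : ℝ, 1 ≤ C ∧
      ∀ (X : Type*) [MetricSpace X] [CompleteSpace X] [MeasurableSpace X] [BorelSpace X]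
        (μ : Measure X) (Ω : Set X) (f u : X → ℝ),
        IsDoublingWith μ CD →
        SupportsPoincareOn μ p univ CX lam →
        IsNeumannDomain μ p CΩ Ω →
        MemLp f ∞ ((perimeterMeasure μ Ω).restrict (frontier Ω)) →
        IsNeumannMinimizer μ p Ω f u →
        ∀ x ∈ frontier Ω, ∀ r R R₀ k : ℝ, 0 < r → r < R → R ≤ R₀ → R₀ < diam Ω / 10 →
          ∫⁻ y in Ω ∩ ball x r,
              minWeakUpperGradient μ p Ω (fun z => max (u z - k) 0) y ^ p ∂μ ≤
            ENNReal.ofReal (C / (R - r) ^ p) *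
                ∫⁻ y in Ω ∩ ball x R, ENNReal.ofReal (max (u y - k) 0 ^ p) ∂μ +
              ENNReal.ofReal C *
                ∫⁻ y in frontier Ω ∩ ball x R,
                  ENNReal.ofReal (|f y| * max (traceFn μ Ω u y - k) 0)
                  ∂(perimeterMeasure μ Ω) := by
  have hp0 : 0 < p := by linarith
  have hC : 1 ≤ p ^ p := Real.one_le_rpow hp.le hp0.le
  -- The factor p comes from differentiating ψ^p and is raised to the power p with the gradient.
  refine ⟨p ^ p, hC, ?_⟩
  intro X _ _ _ _ μ Ω f u hμ _ hΩ hf hu x _ r R R₀ k hr hrR hR hR₀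
  have hd : 0 < diam Ω := by linarith
  have hμΩ : μ Ω ≠ ∞ := (hμ.measure_lt_top hΩ.isBounded).ne
  have hΩm : MeasurableSet Ω := hΩ.isOpen.measurableSet
  have hSm : MeasurableSet (frontier Ω) := isClosed_frontier.measurableSet
  obtain ⟨A, -, hA⟩ := hΩ.regularity
  set P := perimeterMeasure μ Ω with hPdef
  set D : ℝ≥0∞ := ∫⁻ y in frontier Ω ∩ ball x R,
    ENNReal.ofReal (|f y| * max (traceFn μ Ω u y - k) 0) ∂P with hDdef
  -- An infinite boundary term makes the claim trivial; a finite one makes J integrable and allows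
  -- passage to real numbers.
  rcases eq_or_ne D ∞ with hDtop | hDfin
  · have : ENNReal.ofReal (p ^ p) ≠ 0 := by
      rw [Ne, ENNReal.ofReal_eq_zero, not_le]
      linarith
    rw [hDtop, ENNReal.mul_top this, add_top]
    exact le_top
  obtain ⟨ψ, hψ, hψI, hψ1, hψ0⟩ := exists_lipschitz_cutoff x hrR
  obtain ⟨hv, hcacc⟩ := cutoff_memNewtonian_and_caccioppoli hp hμΩ hu.1 k hψ hψI
    (measurableSet_ball (x := x) (ε := r)) (measurableSet_ball (x := x) (ε := R)) hψ1 hψ0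
  set v : X → ℝ := fun x => u x - ψ x ^ p * max (u x - k) 0 with hvdef
  have huint := hu.1.integrableOn hp.le hμΩ
  have hvint := hv.integrableOn hp.le hμΩ
  have htr := hu.1.ae_exists_hasTraceAt (P := P) hp hμ hμΩ hd
    (fun r h0 h1 => (hA r h0 h1).1) (fun r h0 h1 y hy => ((hA r h0 h1).2 y hy).2) hΩ.poincare
  have hpos : ∀ᵐ y ∂(P.restrict (frontier Ω)), ∀ r > 0, 0 < μ (ball y r ∩ Ω) := by
    filter_upwards [ae_restrict_mem hSm] with y hy r hr
    exact measure_ball_inter_pos hμ hΩ.isOpen (frontier_subset_closure hy) hr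
  have hTm := aestronglyMeasurable_traceFn huint hμΩ hpos htr
  let J : X → ℝ := fun y => ψ y ^ p * max (traceFn μ Ω u y - k) 0 * f y
  have hab : (fun y => traceFn μ Ω v y * f y) =ᵐ[P.restrict (frontier Ω)]
      fun y => traceFn μ Ω u y * f y - J y := by
    filter_upwards [htr, hpos] with y ⟨c, hc⟩ hy
    rw [(hc.sub_cutoff hΩm huint hμΩ hp.le k hψ hψI).traceFn_eq hvint hμΩ hy]
    simp only [J]
    rw [hc.traceFn_eq huint hμΩ hy]
    ring
  have hJm : AEStronglyMeasurable J (P.restrict (frontier Ω)) :=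
    (((hψ.continuous.measurable.pow_const p).aestronglyMeasurable).mul
      ((hTm.sub aestronglyMeasurable_const).sup aestronglyMeasurable_const)).mul hf.1
  have hJD : ∫⁻ y in frontier Ω, ‖J y‖ₑ ∂P ≤ D := by
    rw [hDdef, inter_comm, ← Measure.restrict_restrict measurableSet_ball,
      ← lintegral_indicator measurableSet_ball]
    refine lintegral_mono fun y => ?_
    by_cases hy : y ∈ ball x R
    · rw [indicator_of_mem hy, ← ofReal_norm]
      refine ENNReal.ofReal_le_ofReal ?_
      rw [norm_mul, norm_mul, Real.norm_of_nonneg (Real.rpow_nonneg (hψI y).1 _),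
        Real.norm_of_nonneg (le_max_right _ _), mul_comm |f y|, Real.norm_eq_abs]
      gcongr
      exact mul_le_of_le_one_left (le_max_right _ _)
        (Real.rpow_le_one (hψI y).1 (hψI y).2 hp0.le)
    · simp [J, hψ0 y hy, Real.zero_rpow hp0.ne']
  have hbd := integral_le_integral_add_toReal_of_ae_eq_sub hab hJm hDfin hJD
  have hmin := hu.2 v hv
  rw [neumannFunctional, neumannFunctional] at hmin
  have hEu := (hu.1.minWeakUpperGradient_spec hp0).2.1
  have hEv := (hv.minWeakUpperGradient_spec hp0).2.1
  -- The functional is real-valued, so its comparison is lifted to extended reals using finiteness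
  -- of both energies and of D.
  have henergy : ∫⁻ x in Ω, minWeakUpperGradient μ p Ω u x ^ p ∂μ ≤
      ∫⁻ x in Ω, minWeakUpperGradient μ p Ω v x ^ p ∂μ + D := by
    rw [← ENNReal.toReal_le_toReal hEu.ne (ENNReal.add_ne_top.2 ⟨hEv.ne, hDfin⟩),
      ENNReal.toReal_add hEv.ne hDfin]
    linarith
  refine (hcacc D henergy).trans (add_le_add (le_of_eq ?_) ?_)
  · have hRr : 0 < R - r := sub_pos.2 hrR
    rw [Real.coe_toNNReal _ (inv_nonneg.2 hRr.le), ← div_eq_mul_inv,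
      Real.div_rpow hp0.le hRr.le]
  · refine le_mul_of_one_le_left zero_le ?_
    rwa [ENNReal.one_le_ofReal]
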